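/- Let $d\mu(z)=e^{-\pi|z|^2}\,d^2z$ be the Gaussian measure on $\mathbb C$ ($d^2z$ is Lebesgue measure), with $\langle F,G\rangle_{d\mu}=\int F\overline G\,d\mu$, and let $\Delta_z=4\partial_z\partial_{\overline z}$. For $n\ge 0$ let $\mathbf F^n(\mathbb C)=L^2(\mathbb C,d\mu)\cap\ker(\partial_{\overline z})^{n+1}$. For $0\le j\le n$ let $\mathcal F^j(\mathbb C)\subset L^2(\mathbb C,d\mu)$ be the closed subspace of all functions $\frac1{\sqrt{j!}}\left(\sqrt\pi\,\overline z-\frac1{\sqrt\pi}\partial_z\right)^j\Phi$ with $\Phi$ entire and in $L^2(\mathbb C,d\mu)$, and let $P^j:L^2(\mathbb C,d\mu)\to\mathcal F^j(\mathbb C)$ be the orthogonal projection; it maps $\mathbb C[z,\overline z]$ into itself. Put $W_z\Psi(\zeta)=e^{\pi\overline z\zeta-\frac{\pi}{2}|z|^2}\Psi(\zeta-z)$ and $$\mathcal L_\sigma^{\Psi,\Theta}F=\int_{\mathbb C}\sigma(z)\,\langle F,W_z\Psi\rangle_{d\mu}\,W_z\Theta\,d^2z,\qquad F\in L^2(\mathbb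 C,d\mu).$$ Let $BC^\infty(\mathbb C)$ be the space of smooth functions on $\mathbb C$ whose derivatives of all orders (including order $0$) are bounded. A polynomial $D(\overline z,z)\in\mathbb C[z,\overline z]$ (the Wick symbol) defines the polynomial differential operator $D$ obtained by the replacements $z\mapsto-\frac1{\sqrt\pi}\partial_z$, $\overline z\mapsto-\frac1{\sqrt\pi}\partial_{\overline z}$. Degrees are total degrees in $(z,\overline z)$, with $\deg 0=-\infty$. Let $\Psi,\Psi^\star,\Theta,\Theta^\star\in\mathbf F^n(\mathbb C)\cap\mathbb C[z,\overline z]$. For $0\le j,k\le n$ put $$Q_{j,k}=e^{\frac1{4\pi}\Delta_z}\left(P^k\Psi\cdot\overline{P^j\Theta}\right),\qquad Q^\star_{j,k}=e^{\frac1{4\pi}\Delta_z}\left(P^k\Psi^\star\cdot\overline{P^j\Theta^\star}\right).$$ Then the following statements are equivalent: (a) there exists a unique family $\{D_{j,k}\}_{0\le j,k\le n}$ of polynomial differential operators with Wick symbols $D_{j,k}(\overline z,z)$ such that, for every $\sigma\in BC^\infty(\mathbb C)$, $$\mathcal L_\sigma^{\Psi,\Theta}=\sum_{j,k=0}^n\mathcal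 L_{D_{j,k}\sigma}^{P^k\Psi^\star,P^j\Theta^\star}\quad\text{as operators on }L^2(\mathbb C,d\mu);\tag{1}$$ (b) for all $0\le j,k\le n$ the polynomial $Q^\star_{j,k}$ is nonzero and divides $Q_{j,k}$ in $\mathbb C[z,\overline z]$. The equivalence remains true if uniqueness is dropped in (a) and "is nonzero" is dropped in (b) (the zero polynomial divides only itself). If (a) or (b) holds, then (1) holds for every $\sigma\in BC^\infty(\mathbb C)$ with a unique family $\{D_{j,k}\}$, all $P^k\Psi^\star$ and $P^j\Theta^\star$ are nonzero, and for all $0\le j,k\le n$ $$\deg(D_{j,k})=\deg(P^j\Theta)+\deg(P^k\Psi)-\deg(P^j\Theta^\star)-\deg(P^k\Psi^\star).$$ -/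

import Mathlib

open MeasureTheory

noncomputable section

namespace PolyFock

/-- The algebra `ℂ[z, z̄]` of polynomials in `z` and `z̄`; the variable `0` stands for `z` and the
variable `1` for `z̄`. -/
abbrev ZPoly : Type := MvPolynomial (Fin 2) ℂ

/-- The function `z ↦ p(z, z̄)` on `ℂ` given by a polynomial. -/
def polyFun (p : ZPoly) (z : ℂ) : ℂ := MvPolynomial.eval ![z, starRingEnd ℂ z] p

/-- The polynomial that represents `z ↦ conj (p(z, z̄))`: conjugate the coefficients and exchange
`z` with `z̄`. -/
def conjPoly (p : ZPoly) : ZPoly :=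
  MvPolynomial.rename (Equiv.swap (0 : Fin 2) 1) (MvPolynomial.map (starRingEnd ℂ) p)

/-- Total degree in `(z, z̄)`, with `deg 0 = ⊥` (minus infinity). -/
def polyDeg (p : ZPoly) : WithBot ℕ := if p = 0 then ⊥ else (p.totalDegree : WithBot ℕ)

/-- `e^{Δ/4π} p = ∑ₘ (Δ/4π)ᵐ p / m!`, where `Δ = 4 ∂_z ∂_{z̄}`, so that `Δ/4π = π⁻¹ ∂_z ∂_{z̄}`.
The terms with `m` above the degree of `p` vanish. -/
def heat (p : ZPoly) : ZPoly :=
  ∑ m ∈ Finset.range (p.totalDegree + 1),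
    (((m.factorial : ℂ) * (Real.pi : ℂ) ^ m)⁻¹) •
      (fun q : ZPoly => MvPolynomial.pderiv 0 (MvPolynomial.pderiv 1 q))^[m] p

/-- The Gaussian measure `dμ(z) = e^{-π|z|²} d²z` on `ℂ`. -/
def gauss : Measure ℂ :=
  (volume : Measure ℂ).withDensity
    fun z => ((Real.toNNReal (Real.exp (-Real.pi * ‖z‖ ^ 2)) : NNReal) : ENNReal)

/-- The Wirtinger derivative `∂_z = (∂_x - i ∂_ω)/2`, where `z = x + iω`. -/
def dz (f : ℂ → ℂ) (z : ℂ) : ℂ := (fderiv ℝ f z 1 - Complex.I * fderiv ℝ f z Complex.I) / 2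

/-- The Wirtinger derivative `∂_{z̄} = (∂_x + i ∂_ω)/2`, where `z = x + iω`. -/
def dzbar (f : ℂ → ℂ) (z : ℂ) : ℂ := (fderiv ℝ f z 1 + Complex.I * fderiv ℝ f z Complex.I) / 2

/-- The polyanalytic Fock space `𝐅ⁿ(ℂ) = L²(ℂ, dμ) ∩ ker (∂_{z̄})ⁿ⁺¹`. -/
def polyFock (n : ℕ) : Set (ℂ → ℂ) :=
  {F | ContDiff ℝ (⊤ : ℕ∞) F ∧ MemLp F 2 gauss ∧ ∀ z, (dzbar^[n + 1] F) z = 0}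

/-- The raising operator `√π z̄ - (1/√π) ∂_z`. -/
def raise (f : ℂ → ℂ) (z : ℂ) : ℂ :=
  (Real.sqrt Real.pi : ℂ) * starRingEnd ℂ z * f z - (Real.sqrt Real.pi : ℂ)⁻¹ * dz f z

/-- The true polyanalytic Fock space `𝓕ʲ(ℂ)`: all
`(j!)^{-1/2} (√π z̄ - (1/√π) ∂_z)ʲ Φ` with `Φ` in the Fock space, that is, `Φ` entire and in
`L²(ℂ, dμ)`. (These functions already form a closed linear subspace of `L²(ℂ, dμ)`; taking the
closed linear span adds nothing.) -/
def trueFock (j : ℕ) : Submodule ℂ (Lp ℂ 2 gauss) :=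
  (Submodule.span ℂ {f : Lp ℂ 2 gauss | ∃ Φ : ℂ → ℂ, Differentiable ℂ Φ ∧ MemLp Φ 2 gauss ∧
    f =ᵐ[gauss] fun z => (Real.sqrt (j.factorial : ℝ) : ℂ)⁻¹ * (raise^[j] Φ) z}).topologicalClosure

instance (j : ℕ) : (trueFock j).HasOrthogonalProjection := by
  unfold trueFock; infer_instance

theorem integrable_gauss (m : ℕ) :
    Integrable (fun z : ℂ => ‖z‖ ^ m * Real.exp (-Real.pi * ‖z‖ ^ 2)) volume := by
  apply Integrable.of_integral_ne_zero
  have h := Complex.integral_rpow_mul_exp_neg_mul_rpow (p := 2) (q := m) (b := Real.pi)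
    (by norm_num) (by have : (0 : ℝ) ≤ m := m.cast_nonneg
                      linarith) Real.pi_pos
  have e : (fun z : ℂ => ‖z‖ ^ m * Real.exp (-Real.pi * ‖z‖ ^ 2))
      = fun z : ℂ => ‖z‖ ^ (m : ℝ) * Real.exp (-Real.pi * ‖z‖ ^ (2 : ℝ)) := by
    funext z
    rw [Real.rpow_natCast, Real.rpow_two]
  rw [e, h]
  have hg : 0 < Real.Gamma (((m : ℝ) + 2) / 2) := Real.Gamma_pos_of_pos (by positivity)
  have := Real.pi_pos
  positivity

theorem continuous_polyFun (p : ZPoly) : Continuous (polyFun p) := by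
  unfold polyFun
  refine (MvPolynomial.continuous_eval p).comp (continuous_pi fun i => ?_)
  fin_cases i
  · exact continuous_id
  · exact Complex.continuous_conj

/-- Every polynomial in `z, z̄` lies in `L²(ℂ, dμ)`. -/
theorem memLp_polyFun (p : ZPoly) : MemLp (polyFun p) 2 gauss := by
  induction p using MvPolynomial.induction_on' with
  | monomial u a =>
    refine (memLp_two_iff_integrable_sq_norm
      (continuous_polyFun _).aestronglyMeasurable).2 ?_
    unfold gauss
    rw [integrable_withDensity_iff_integrable_coe_smul (by fun_prop)]
    refine ((integrable_gauss (2 * (u 0 + u 1))).const_mul (‖a‖ ^ 2)).congr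
      (Filter.Eventually.of_forall fun z => ?_)
    simp only [polyFun, MvPolynomial.eval_monomial, Finsupp.prod_fintype, Fin.prod_univ_two,
      pow_zero, implies_true, Matrix.cons_val_zero, Matrix.cons_val_one, norm_mul, norm_pow,
      RCLike.norm_conj, smul_eq_mul, Real.coe_toNNReal _ (Real.exp_pos _).le]
    ring
  | add p q hp hq =>
    have e : polyFun (p + q) = polyFun p + polyFun q := by
      funext z
      simp [polyFun]
    rw [e]
    exact hp.add hq

/-- The polynomial in `z, z̄` that represents an element of `L²(ℂ, dμ)` (it is unique, because
polynomials that agree almost everywhere are equal); `0` if the element is not a polynomial. -/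
def repPoly (f : Lp ℂ 2 gauss) : ZPoly := by
  classical
  exact if h : ∃ p : ZPoly, f =ᵐ[gauss] polyFun p then h.choose else 0

/-- The polynomial `Pᵏ p`, where `Pᵏ : L²(ℂ, dμ) → 𝓕ᵏ(ℂ)` is the orthogonal projection. (The
projection of a polynomial is again a polynomial.) -/
def proj (k : ℕ) (p : ZPoly) : ZPoly :=
  repPoly ((trueFock k).starProjection ((memLp_polyFun p).toLp (polyFun p)))

/-- The Weyl operators `(W_z Ψ)(ζ) = e^{π z̄ ζ - (π/2)|z|²} Ψ(ζ - z)`. -/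
def weyl (z : ℂ) (Ψ : ℂ → ℂ) (ζ : ℂ) : ℂ :=
  Complex.exp ((Real.pi : ℂ) * starRingEnd ℂ z * ζ - ((Real.pi / 2 * ‖z‖ ^ 2 : ℝ) : ℂ)) * Ψ (ζ - z)

/-- The inner product `⟨F, G⟩ = ∫ F conj(G) dμ` of `L²(ℂ, dμ)`. -/
def ip (F G : ℂ → ℂ) : ℂ := ∫ z, F z * starRingEnd ℂ (G z) ∂gauss

/-- The Berezin-Toeplitz operator `𝓛_σ^{Ψ,Θ} F = ∫ σ(z) ⟨F, W_z Ψ⟩ W_z Θ d²z`. For polynomial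
windows, a bounded measurable symbol `σ` and `F ∈ L²(ℂ, dμ)` the integral converges absolutely at
every point. -/
def berezinToeplitz (σ Ψ Θ F : ℂ → ℂ) (ζ : ℂ) : ℂ :=
  ∫ z : ℂ, σ z * ip F (weyl z Ψ) * weyl z Θ ζ

/-- `BC^∞(ℂ)`: smooth functions all of whose derivatives, of every order, are bounded. -/
def BCInf (σ : ℂ → ℂ) : Prop :=
  ContDiff ℝ (⊤ : ℕ∞) σ ∧ ∀ m : ℕ, ∃ C : ℝ, ∀ z, ‖iteratedFDeriv ℝ m σ z‖ ≤ C

/-- The polynomial differential operator with Wick symbol `D(z̄, z)`, obtained by the replacements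
`z ↦ -(1/√π) ∂_z` and `z̄ ↦ -(1/√π) ∂_{z̄}`, applied to `σ`. -/
def diffOp (D : ZPoly) (σ : ℂ → ℂ) (z : ℂ) : ℂ :=
  ∑ m ∈ D.support, D.coeff m * (-(Real.sqrt Real.pi : ℂ)⁻¹) ^ (m 0 + m 1) *
    (dzbar^[m 1] (dz^[m 0] σ)) z

/-- The family `D` of Wick symbols satisfies
`𝓛_σ^{Ψ,Θ} = ∑_{j,k=0}^n 𝓛_{D_{j,k} σ}^{Pᵏ Ψ⋆, Pʲ Θ⋆}` as operators on `L²(ℂ, dμ)`, for every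
`σ ∈ BC^∞(ℂ)`. -/
def LocalizationIdentity (n : ℕ) (Ψ Θ Ψs Θs : ZPoly) (D : Fin (n + 1) → Fin (n + 1) → ZPoly) :
    Prop :=
  ∀ σ : ℂ → ℂ, BCInf σ → ∀ F : ℂ → ℂ, MemLp F 2 gauss →
    berezinToeplitz σ (polyFun Ψ) (polyFun Θ) F =ᵐ[gauss]
      ∑ j : Fin (n + 1), ∑ k : Fin (n + 1),
        berezinToeplitz (diffOp (D j k) σ) (polyFun (proj k Ψs)) (polyFun (proj j Θs)) F

/-- The polynomial `e^{Δ/4π} (Pᵏ Ψ · conj (Pʲ Θ))`. -/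
def heatProd (j k : ℕ) (Ψ Θ : ZPoly) : ZPoly := heat (proj k Ψ * conjPoly (proj j Θ))

end PolyFock

end

noncomputable section

namespace PolyFock

open MvPolynomial

/-! Write `R` for the raising operator `√π z̄ - (1/√π) ∂_z`. The argument turns the operator
identity into polynomial identities, one for each pair `(j, k)`.

Windows. A polynomial killed by `∂_{z̄}^{n+1}` is `∑_{k ≤ n} R^k φ_k` with `φ_k ∈ ℂ[z]`
(`exists_raise_decomposition`). The summands are its projections `P^k`, because `R` is the adjoint
of `(1/√π) ∂_{z̄}` and different levels are therefore orthogonal (`proj_sum_raise`). Moreover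
`e^{Δ/4π}(R^k φ · conj (R^j θ))` is `e^{Δ/4π}(φ · conj θ)` times a nonzero polynomial depending only
on `k` and `j` (`heat_raise_mul_conj_raise`). Divisibility of `Q_{j,k}` by `Q⋆_{j,k}` can thus be
tested on the holomorphic components.

Symbols. For fixed `k, j, σ, F, ζ` the value of `𝓛_σ^{R^k φ, R^j θ} F` at `ζ` is a linear functional
of the coefficientwise conjugate of `φ · conj θ` (`btForm_map_conj`). Integration by parts in `z`
moves a derivative of `σ` onto the windows, where it acts as `-π` times `X_i - π⁻¹ ∂_j`. Conjugation
by `e^{Δ/4π}` turns this into multiplication by `-π X_i` (`heatForm_dz`, `heatForm_dzbar`). Hence a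
differential operator applied to `σ` multiplies `e^{Δ/4π}(φ · conj θ)` by its rescaled Wick symbol
(`berezinToeplitz_diffOp`), and the polynomial identities `e^{Δ/4π}(φ_k conj θ_j) = symbolEquiv
D_{j,k} · e^{Δ/4π}(φ⋆_k conj θ⋆_j)` imply the operator identity.

Converse. A plane wave is an eigenfunction of `∂_z` and `∂_{z̄}`, so for it the functional is a
point evaluation times an explicit constant (`heatForm_planeWave`). Testing on `F = z̄^{k₀}`
isolates `k = k₀`, and the powers `(ζ̄ + w̄)^j` in the result separate the indices `j`. Letting the
frequency `w` vary recovers each polynomial identity (`localizationIdentity_iff`).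

The rest is algebra in the integral domain `ℂ[z, z̄]`: cancellation gives uniqueness, and degrees
add under products and are preserved by `e^{Δ/4π}`. -/

/-- The complex number `√π`. -/
def rtpi : ℂ := (Real.sqrt Real.pi : ℂ)

theorem rtpi_ne_zero : rtpi ≠ 0 := by
  have := Real.sqrt_pos.2 Real.pi_pos
  unfold rtpi
  exact_mod_cast this.ne'

theorem rtpi_mul_self : rtpi * rtpi = (Real.pi : ℂ) := by
  unfold rtpi
  exact_mod_cast Real.mul_self_sqrt Real.pi_pos.le

theorem pi_ne_zero' : (Real.pi : ℂ) ≠ 0 := by exact_mod_cast Real.pi_ne_zero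

theorem conj_rtpi : starRingEnd ℂ rtpi = rtpi := Complex.conj_ofReal _

theorem pderiv_comm (p : ZPoly) : pderiv 0 (pderiv 1 p) = pderiv 1 (pderiv 0 p) := by
  ext m
  simp only [coeff_pderiv, Finsupp.add_apply, add_right_comm m]
  simp
  ring

/-! ### Raising and lowering operators on polynomials -/

/-- The raising operator on polynomials. -/
def raiseP : ZPoly →ₗ[ℂ] ZPoly :=
  rtpi • LinearMap.mulLeft ℂ (X 1) - rtpi⁻¹ • (pderiv 0).toLinearMap

theorem raiseP_apply (p : ZPoly) : raiseP p = C rtpi * (X 1 * p) - C rtpi⁻¹ * pderiv 0 p := by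
  simp [raiseP, smul_eq_C_mul]

theorem C_rtpi_mul_self : (C rtpi * C rtpi : ZPoly) = C (Real.pi : ℂ) := by
  rw [← C_mul, rtpi_mul_self]

theorem C_rtpi_inv_mul : (C rtpi * C rtpi⁻¹ : ZPoly) = 1 := by
  rw [← C_mul, mul_inv_cancel₀ rtpi_ne_zero, C_1]

theorem pderiv_one_raiseP (p : ZPoly) :
    pderiv 1 (raiseP p) = raiseP (pderiv 1 p) + C rtpi * p := by
  rw [raiseP_apply, raiseP_apply, map_sub, pderiv_C_mul, pderiv_C_mul, pderiv_comm, pderiv_mul,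
    pderiv_X_self]
  ring

theorem pderiv_zero_raiseP (p : ZPoly) : pderiv 0 (raiseP p) = raiseP (pderiv 0 p) := by
  rw [raiseP_apply, raiseP_apply, map_sub, pderiv_C_mul, pderiv_C_mul, pderiv_mul,
    pderiv_X_of_ne (by decide)]
  ring

theorem pderiv_zero_raiseP_iterate (k : ℕ) (p : ZPoly) :
    pderiv 0 (raiseP^[k] p) = raiseP^[k] (pderiv 0 p) := by
  induction k with
  | zero => rfl
  | succ k ih => rw [Function.iterate_succ_apply', Function.iterate_succ_apply',
      pderiv_zero_raiseP, ih]

theorem pderiv_one_raiseP_iterate (k : ℕ) {φ : ZPoly} (h : pderiv 1 φ = 0) :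
    pderiv 1 (raiseP^[k + 1] φ) = C (rtpi * (k + 1)) * raiseP^[k] φ := by
  induction k with
  | zero => simp [pderiv_one_raiseP, h]
  | succ k ih =>
    rw [Function.iterate_succ_apply', pderiv_one_raiseP, ih, ← smul_eq_C_mul, map_smul,
      ← Function.iterate_succ_apply' raiseP, smul_eq_C_mul]
    push_cast
    simp only [C_mul, C_add, C_1]
    ring

/-- At `k = 0` the truncated `k - 1` is harmless, since the factor `k` vanishes there. -/
theorem pderiv_one_raiseP_iterate' (k : ℕ) {φ : ZPoly} (h : pderiv 1 φ = 0) :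
    pderiv 1 (raiseP^[k] φ) = C (rtpi * k) * raiseP^[k - 1] φ := by
  cases k with
  | zero => simpa using h
  | succ k => rw [pderiv_one_raiseP_iterate k h]; simp

/-- The lowering operator `(1/√π) ∂_{z̄}` on polynomials. -/
def lowerP : ZPoly →ₗ[ℂ] ZPoly := rtpi⁻¹ • (pderiv 1).toLinearMap

theorem lowerP_apply (p : ZPoly) : lowerP p = C rtpi⁻¹ * pderiv 1 p := by
  simp [lowerP, smul_eq_C_mul]

theorem lowerP_raiseP_iterate (k : ℕ) {φ : ZPoly} (h : pderiv 1 φ = 0) :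
    lowerP (raiseP^[k] φ) = (k : ℂ) • raiseP^[k - 1] φ := by
  rw [lowerP_apply, pderiv_one_raiseP_iterate' k h, smul_eq_C_mul, ← mul_assoc, ← C_mul,
    ← mul_assoc, inv_mul_cancel₀ rtpi_ne_zero, one_mul]

/-- Each lowering removes one raising. For `l > k` the falling factorial is zero, which later gives
half of the orthogonality of the levels. -/
theorem lowerP_iterate_raiseP_iterate (k l : ℕ) {φ : ZPoly} (h : pderiv 1 φ = 0) :
    lowerP^[l] (raiseP^[k] φ) = (k.descFactorial l : ℂ) • raiseP^[k - l] φ := by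
  induction l with
  | zero => simp
  | succ l ih =>
    rw [Function.iterate_succ_apply', ih, map_smul, lowerP_raiseP_iterate _ h, smul_smul,
      Nat.descFactorial_succ]
    push_cast
    rw [mul_comm, Nat.sub_sub]

theorem pderiv_one_iterate_raiseP_iterate (k : ℕ) {φ : ZPoly} (h : pderiv 1 φ = 0) :
    (pderiv 1)^[k] (raiseP^[k] φ) = C (rtpi ^ k * (k.factorial : ℂ)) * φ := by
  induction k with
  | zero => simp
  | succ k ih =>
    have hs : ∀ (n : ℕ) (c : ℂ) (q : ZPoly),
        (pderiv 1)^[n] (C c * q) = C c * (pderiv (1 : Fin 2))^[n] q := by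
      intro n c
      induction n with
      | zero => intro q; rfl
      | succ n ih => intro q; rw [Function.iterate_succ_apply, pderiv_C_mul, ih]; rfl
    rw [Function.iterate_succ_apply, pderiv_one_raiseP_iterate k h, hs, ih, Nat.factorial_succ,
      ← mul_assoc, ← C_mul]
    push_cast
    ring_nf

/-- Every polynomial killed by `∂_{z̄}ⁿ` is `∑_{k<n} Rᵏ φₖ` with `φₖ ∈ ℂ[z]`. -/
theorem exists_raise_decomposition (n : ℕ) : ∀ p : ZPoly, (pderiv 1)^[n] p = 0 →
    ∃ φ : ℕ → ZPoly, (∀ k, pderiv 1 (φ k) = 0) ∧ p = ∑ k ∈ Finset.range n, raiseP^[k] (φ k) := by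
  induction n with
  | zero => exact fun p hp => ⟨0, by simp, by simpa using hp⟩
  | succ n ih =>
    intro p hp
    set c : ℂ := rtpi ^ n * (n.factorial : ℂ) with hc
    have hc0 : c ≠ 0 := mul_ne_zero (pow_ne_zero _ rtpi_ne_zero)
      (by exact_mod_cast n.factorial_ne_zero)
    -- The top component: `∂_{z̄}^n` kills the levels below `n` and multiplies `φ` by `c` in `R^n
    -- φ`.
    set χ : ZPoly := C c⁻¹ * (pderiv 1)^[n] p with hχ
    have hχ0 : pderiv 1 χ = 0 := by
      rw [hχ, pderiv_C_mul, ← Function.iterate_succ_apply' (pderiv (1 : Fin 2)), hp, mul_zero]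
    have hsub : ∀ (m : ℕ) (a b : ZPoly),
        (pderiv (1 : Fin 2))^[m] (a - b) = (pderiv 1)^[m] a - (pderiv 1)^[m] b :=
      fun m a b => iterate_map_sub _ _ _ _
    obtain ⟨φ, h1, h2⟩ := ih (p - raiseP^[n] χ) (by
      rw [hsub, pderiv_one_iterate_raiseP_iterate n hχ0, hχ, ← mul_assoc, ← C_mul, ← hc,
        mul_inv_cancel₀ hc0]
      simp)
    refine ⟨Function.update φ n χ, fun k => ?_, ?_⟩
    · rcases eq_or_ne k n with rfl | hk
      · simpa using hχ0
      · simpa [hk] using h1 k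
    · rw [Finset.sum_range_succ, Finset.sum_congr rfl (g := fun k => raiseP^[k] (φ k)), ← h2]
      · simp
      · intro k hk
        rw [Function.update_of_ne (Finset.mem_range.1 hk).ne]

/-! ### The heat operator -/

/-- `∂_z ∂_{z̄}` on polynomials. -/
def lap : ZPoly →ₗ[ℂ] ZPoly := (pderiv 0).toLinearMap ∘ₗ (pderiv 1).toLinearMap

theorem lap_apply (p : ZPoly) : lap p = pderiv 0 (pderiv 1 p) := rfl

theorem totalDegree_pderiv_lt {i : Fin 2} {p : ZPoly} {d : ℕ} (h : p.totalDegree < d + 1) :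
    pderiv i p = 0 ∨ (pderiv i p).totalDegree < d := by
  by_cases h0 : pderiv i p = 0
  · exact Or.inl h0
  right
  obtain ⟨m, hm, hd⟩ := Finset.exists_mem_eq_sup (pderiv i p).support
    (support_nonempty.2 h0) (fun m => m.sum fun _ e => e)
  rw [totalDegree, hd]
  have h1 : m + Finsupp.single i 1 ∈ p.support := by
    rw [mem_support_iff] at hm ⊢
    rw [coeff_pderiv] at hm
    exact left_ne_zero_of_mul hm
  have h2 := le_totalDegree h1
  rw [Finsupp.sum_add_index' (by simp) (by simp), Finsupp.sum_single_index rfl] at h2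
  omega

theorem totalDegree_lap_pow {p : ZPoly} (m : ℕ) :
    (lap ^ m) p = 0 ∨ ((lap ^ m) p).totalDegree + m ≤ p.totalDegree := by
  induction m with
  | zero => simp
  | succ m ih =>
    rw [pow_succ', Module.End.mul_apply, lap_apply]
    rcases ih with h | h
    · simp [h]
    rcases totalDegree_pderiv_lt (i := 1) (Nat.lt_succ_self ((lap ^ m) p).totalDegree) with h1 | h1
    · simp [h1]
    rcases totalDegree_pderiv_lt (i := 0) (h1.trans (Nat.lt_succ_self _)) with h2 | h2
    · simp [h2]
    right; omega

theorem lap_pow_eq_zero {p : ZPoly} {m : ℕ} (h : p.totalDegree < m) : (lap ^ m) p = 0 := by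
  rcases totalDegree_lap_pow (p := p) m with h1 | h1
  · exact h1
  · omega

/-- The coefficients of the exponential series of `Δ/4π`. -/
def heatCoeff (m : ℕ) : ℂ := ((m.factorial : ℂ) * (Real.pi : ℂ) ^ m)⁻¹

/-- The series may be cut at any `K` above the degree, so polynomials of different degrees can share
one truncation; this is what makes linearity accessible. -/
theorem heat_eq_sum {p : ZPoly} {K : ℕ} (h : p.totalDegree < K) :
    heat p = ∑ m ∈ Finset.range K, heatCoeff m • (lap ^ m) p := by
  have h1 : heat p = ∑ m ∈ Finset.range (p.totalDegree + 1), heatCoeff m • (lap ^ m) p :=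
    Finset.sum_congr rfl fun m _ => by rw [Module.End.pow_apply]; rfl
  rw [h1]
  refine Finset.sum_subset (Finset.range_subset_range.2 h) fun m _ hm => ?_
  rw [lap_pow_eq_zero (by simpa [Nat.lt_succ_iff] using hm), smul_zero]

/-- The heat operator as a linear map. -/
def heatL : ZPoly →ₗ[ℂ] ZPoly where
  toFun := heat
  map_add' p q := by
    rw [heat_eq_sum (p := p + q) (K := max p.totalDegree q.totalDegree + 1)
        (Nat.lt_succ_of_le (totalDegree_add p q)),
      heat_eq_sum (p := p) (K := max p.totalDegree q.totalDegree + 1) (by omega),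
      heat_eq_sum (p := q) (K := max p.totalDegree q.totalDegree + 1) (by omega),
      ← Finset.sum_add_distrib]
    simp only [map_add, smul_add]
  map_smul' c p := by
    rw [heat_eq_sum (p := c • p) (Nat.lt_succ_of_le (totalDegree_smul_le c p)),
      heat_eq_sum (p := p) (Nat.lt_succ_self _), RingHom.id_apply, Finset.smul_sum]
    exact Finset.sum_congr rfl fun m _ => by rw [map_smul, smul_comm]

theorem heat_add (p q : ZPoly) : heat (p + q) = heat p + heat q := map_add heatL p q

theorem heat_sub (p q : ZPoly) : heat (p - q) = heat p - heat q := map_sub heatL p q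

theorem heat_C_mul (c : ℂ) (p : ZPoly) : heat (C c * p) = C c * heat p := by
  rw [← smul_eq_C_mul, ← smul_eq_C_mul]; exact map_smul heatL c p

theorem heat_one : heat 1 = 1 := by
  rw [heat_eq_sum (K := 1) (by simp)]; simp [heatCoeff]

theorem heat_zero : heat 0 = 0 := map_zero heatL

theorem pderiv_lap (i : Fin 2) (p : ZPoly) : pderiv i (lap p) = lap (pderiv i p) := by
  fin_cases i <;> simp [lap_apply, pderiv_comm]

theorem pderiv_lap_pow (i : Fin 2) (m : ℕ) (p : ZPoly) :
    pderiv i ((lap ^ m) p) = (lap ^ m) (pderiv i p) := by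
  induction m with
  | zero => rfl
  | succ m ih => rw [pow_succ', Module.End.mul_apply, pderiv_lap, ih]; rfl

theorem pderiv_heat (i : Fin 2) (p : ZPoly) : pderiv i (heat p) = heat (pderiv i p) := by
  set K := max p.totalDegree (pderiv i p).totalDegree + 1
  rw [heat_eq_sum (p := p) (K := K) (by omega), heat_eq_sum (p := pderiv i p) (K := K) (by omega),
    map_sum]
  exact Finset.sum_congr rfl fun m _ => by rw [Derivation.map_smul, pderiv_lap_pow]

theorem lap_X_mul {i j : Fin 2} (h : i ≠ j) (p : ZPoly) :
    lap (X i * p) = X i * lap p + pderiv j p := by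
  fin_cases i <;> fin_cases j <;> simp [lap_apply] at h ⊢

theorem lap_pow_X_mul {i j : Fin 2} (h : i ≠ j) (m : ℕ) (p : ZPoly) :
    (lap ^ (m + 1)) (X i * p) =
      X i * (lap ^ (m + 1)) p + ((m : ℂ) + 1) • pderiv j ((lap ^ m) p) := by
  induction m with
  | zero => simp [lap_X_mul h]
  | succ m ih =>
    rw [pow_succ', Module.End.mul_apply, ih, map_add, lap_X_mul h, map_smul, ← pderiv_lap,
      ← Module.End.mul_apply, ← Module.End.mul_apply, ← pow_succ', ← pow_succ']
    push_cast
    simp only [smul_eq_C_mul, C_add, C_1]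
    ring

/-- The commutator of `Δ/4π` with multiplication by `X i` is `π⁻¹ ∂_j`, which commutes with `Δ`;
hence the exponential picks up just this one correction term. -/
theorem heat_X_mul {i j : Fin 2} (h : i ≠ j) (p : ZPoly) :
    heat (X i * p) = X i * heat p + C (Real.pi : ℂ)⁻¹ * heat (pderiv j p) := by
  set K := max p.totalDegree (X i * p).totalDegree + 1
  have hp : p.totalDegree < K := by omega
  rw [heat_eq_sum (p := X i * p) (K := K + 1) (by omega), Finset.sum_range_succ',
    ← pderiv_heat, heat_eq_sum hp]
  -- The sum is first lengthened by the vanishing term of index `K`, so that the shifted sum again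
  -- has `K` terms.
  have h2 : ∑ m ∈ Finset.range K, heatCoeff m • (lap ^ m) p =
      ∑ m ∈ Finset.range K, heatCoeff (m + 1) • (lap ^ (m + 1)) p + heatCoeff 0 • p := by
    rw [← heat_eq_sum hp, heat_eq_sum (hp.trans (Nat.lt_succ_self _)), Finset.sum_range_succ']
    simp
  have h3 : ∑ m ∈ Finset.range K, heatCoeff (m + 1) • (lap ^ (m + 1)) (X i * p) =
      X i * ∑ m ∈ Finset.range K, heatCoeff (m + 1) • (lap ^ (m + 1)) p +
      C (Real.pi : ℂ)⁻¹ * pderiv j (∑ m ∈ Finset.range K, heatCoeff m • (lap ^ m) p) := by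
    rw [map_sum, Finset.mul_sum, Finset.mul_sum, ← Finset.sum_add_distrib]
    refine Finset.sum_congr rfl fun m _ => ?_
    rw [lap_pow_X_mul h, Derivation.map_smul]
    have hc : heatCoeff (m + 1) * ((m : ℂ) + 1) = (Real.pi : ℂ)⁻¹ * heatCoeff m := by
      unfold heatCoeff
      rw [Nat.factorial_succ]
      have := pi_ne_zero'
      have h1 : (m.factorial : ℂ) ≠ 0 := by exact_mod_cast m.factorial_ne_zero
      have h2 : (m : ℂ) + 1 ≠ 0 := by exact_mod_cast m.succ_ne_zero
      push_cast
      field_simp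
      ring
    rw [smul_add, smul_smul, hc]
    simp only [smul_eq_C_mul, C_mul]
    ring
  rw [h3, h2]
  simp only [pow_zero, Module.End.one_apply, map_add, smul_eq_C_mul]
  ring

/-- The constant term of the series is the identity and the others lower the degree. The hypothesis
excludes constants, for which the strict inequality would read `0 < 0`. -/
theorem totalDegree_heat_sub_lt {p : ZPoly} (h : heat p ≠ p) :
    (heat p - p).totalDegree < p.totalDegree := by
  have h1 : heat p - p = ∑ m ∈ Finset.range p.totalDegree, heatCoeff (m + 1) • (lap ^ (m + 1)) p := by
    rw [heat_eq_sum (Nat.lt_succ_self _), Finset.sum_range_succ']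
    simp [heatCoeff]
  have hd : 0 < p.totalDegree := by
    by_contra hd
    rw [Nat.eq_zero_of_not_pos hd] at h1
    exact h (sub_eq_zero.1 (by simpa using h1))
  rw [h1]
  refine lt_of_le_of_lt (totalDegree_finsetSum_le (d := p.totalDegree - 1) fun m _ => ?_)
    (by omega)
  refine (totalDegree_smul_le _ _).trans ?_
  rcases totalDegree_lap_pow (p := p) (m + 1) with h2 | h2
  · simp [h2]
  · omega

theorem totalDegree_heat (p : ZPoly) : (heat p).totalDegree = p.totalDegree := by
  by_cases h : heat p = p
  · rw [h]
  · have := totalDegree_add_eq_left_of_totalDegree_lt (totalDegree_heat_sub_lt h)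
    rwa [add_sub_cancel] at this

/-- If `heat p = 0` with `p ≠ 0`, then `heat p - p = -p` would have smaller degree than `p`. -/
theorem heat_eq_zero {p : ZPoly} : heat p = 0 ↔ p = 0 := by
  refine ⟨fun h => ?_, fun h => by rw [h, heat_zero]⟩
  by_contra hp
  have h1 := totalDegree_heat_sub_lt (p := p) (by rw [h]; exact fun e => hp e.symm)
  simp [h] at h1

/-! ### Conjugation -/

theorem conjPoly_add (p q : ZPoly) : conjPoly (p + q) = conjPoly p + conjPoly q := by
  simp [conjPoly]

theorem conjPoly_sub (p q : ZPoly) : conjPoly (p - q) = conjPoly p - conjPoly q := by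
  simp [conjPoly]

theorem conjPoly_mul (p q : ZPoly) : conjPoly (p * q) = conjPoly p * conjPoly q := by
  simp [conjPoly]

theorem conjPoly_C (c : ℂ) : conjPoly (C c) = C (starRingEnd ℂ c) := by
  simp [conjPoly]

theorem conjPoly_X_one : conjPoly (X 1) = X 0 := by
  simp [conjPoly]

theorem conjPoly_zero : conjPoly 0 = 0 := by simp [conjPoly]

theorem map_conj_injective :
    Function.Injective (MvPolynomial.map (σ := Fin 2) (starRingEnd ℂ)) :=
  MvPolynomial.map_injective _ (starRingEnd ℂ).injective

theorem conjPoly_eq_zero {p : ZPoly} : conjPoly p = 0 ↔ p = 0 := by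
  refine ⟨fun h => map_conj_injective ?_, fun h => by rw [h, conjPoly_zero]⟩
  refine rename_injective _ (Equiv.swap (0 : Fin 2) 1).injective ?_
  rw [map_zero, map_zero]
  exact h

theorem totalDegree_map_conj (p : ZPoly) :
    (MvPolynomial.map (starRingEnd ℂ) p).totalDegree = p.totalDegree := by
  simp only [totalDegree, support_map_of_injective p (starRingEnd ℂ).injective]

theorem totalDegree_conjPoly (p : ZPoly) : (conjPoly p).totalDegree = p.totalDegree := by
  rw [conjPoly, ← totalDegree_map_conj p]
  exact totalDegree_renameEquiv (Equiv.swap (0 : Fin 2) 1) _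

theorem pderiv_conjPoly {i j : Fin 2} (h : i ≠ j) (p : ZPoly) :
    pderiv i (conjPoly p) = conjPoly (pderiv j p) := by
  have hij : i = Equiv.swap (0 : Fin 2) 1 j := by
    fin_cases i <;> fin_cases j <;> simp at h ⊢
  rw [conjPoly, conjPoly, hij, pderiv_rename (Equiv.injective _), pderiv_map]

theorem conjPoly_raiseP (p : ZPoly) :
    conjPoly (raiseP p) = C rtpi * (X 0 * conjPoly p) - C rtpi⁻¹ * pderiv 1 (conjPoly p) := by
  rw [raiseP_apply, conjPoly_sub, conjPoly_mul, conjPoly_mul, conjPoly_mul, conjPoly_C,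
    conjPoly_C, conjPoly_X_one, pderiv_conjPoly (by decide : (1 : Fin 2) ≠ 0), map_inv₀, conj_rtpi]

/-! ### The factorization of the heat transform of products of windows -/

theorem C_rtpi_mul_pi_inv : (C rtpi * C (Real.pi : ℂ)⁻¹ : ZPoly) = C rtpi⁻¹ := by
  rw [← C_mul, ← rtpi_mul_self, mul_inv, ← mul_assoc, mul_inv_cancel₀ rtpi_ne_zero, one_mul]

/-- Commuting `X 1` past the heat operator produces a derivative of the product `p * q`. Its `∂_z p`
part cancels the derivative inside `raiseP p`, and only `∂_z q` survives. -/
theorem heat_raiseP_mul (p q : ZPoly) :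
    heat (raiseP p * q) = C rtpi * X 1 * heat (p * q) + C rtpi⁻¹ * heat (p * pderiv 0 q) := by
  have h1 : raiseP p * q = C rtpi * (X 1 * (p * q)) - C rtpi⁻¹ * (pderiv 0 p * q) := by
    rw [raiseP_apply]; ring
  rw [h1, heat_sub, heat_C_mul, heat_C_mul, heat_X_mul (by decide : (1 : Fin 2) ≠ 0), pderiv_mul,
    heat_add, mul_add, ← mul_assoc (C rtpi) (C _⁻¹), C_rtpi_mul_pi_inv]
  ring

theorem heat_mul_conjPoly_raiseP {φ : ZPoly} (h : pderiv 1 φ = 0) (q : ZPoly) :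
    heat (φ * conjPoly (raiseP q)) = C rtpi * X 0 * heat (φ * conjPoly q) := by
  have h1 : φ * conjPoly (raiseP q) =
      C rtpi * (X 0 * (φ * conjPoly q)) - C rtpi⁻¹ * (pderiv 1 (φ * conjPoly q)) := by
    rw [conjPoly_raiseP, pderiv_mul, h]; ring
  rw [h1, heat_sub, heat_C_mul, heat_C_mul, heat_X_mul (by decide : (0 : Fin 2) ≠ 1),
    mul_add, ← mul_assoc (C rtpi) (C _⁻¹), C_rtpi_mul_pi_inv]
  ring

/-- The universal factor of the heat transform of `Rᵏφ · conj (Rʲθ)`. -/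
def windowFactor : ℕ → ℕ → ZPoly
  | 0, j => (C rtpi * X 0) ^ j
  | k + 1, j => C rtpi * X 1 * windowFactor k j + C (j : ℂ) * windowFactor k (j - 1)

/-- Its value at `X 0 = X 1 = 1` is positive, because the recursion has nonnegative coefficients and
a positive leading one. -/
theorem windowFactor_ne_zero (k j : ℕ) : windowFactor k j ≠ 0 := by
  have key : ∀ k j, ∃ r : ℝ, 0 < r ∧ eval (fun _ => (1 : ℂ)) (windowFactor k j) = (r : ℂ) := by
    have hs := Real.sqrt_pos.2 Real.pi_pos
    intro k
    induction k with
    | zero => exact fun j => ⟨Real.sqrt Real.pi ^ j, by positivity, by simp [windowFactor, rtpi]⟩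
    | succ k ih =>
      intro j
      obtain ⟨r, hr, e⟩ := ih j
      obtain ⟨r', hr', e'⟩ := ih (j - 1)
      exact ⟨Real.sqrt Real.pi * r + j * r', by positivity, by simp [windowFactor, rtpi, e, e']⟩
  intro h
  obtain ⟨r, hr, e⟩ := key k j
  rw [h, map_zero] at e
  exact hr.ne (by exact_mod_cast e)

/-- The raisings of `φ` are peeled off first; each one differentiates `conj (R^j θ)` and so lowers
`j` with the factor `j`. At `k = 0` holomorphy of `φ` lets each raising of `θ` come out as a factor
`√π X 0`. The factor never sees `φ` or `θ`, so it cancels when two pairs of windows are compared. -/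
theorem heat_raise_mul_conj_raise {φ θ : ZPoly} (hφ : pderiv 1 φ = 0) (hθ : pderiv 1 θ = 0)
    (k j : ℕ) : heat (raiseP^[k] φ * conjPoly (raiseP^[j] θ)) =
      windowFactor k j * heat (φ * conjPoly θ) := by
  induction k generalizing j with
  | zero =>
    induction j with
    | zero => simp [windowFactor]
    | succ j ih =>
      rw [Function.iterate_succ_apply', Function.iterate_zero_apply, heat_mul_conjPoly_raiseP hφ]
      rw [Function.iterate_zero_apply] at ih
      rw [ih, windowFactor, windowFactor]
      ring
  | succ k ih =>
    rw [Function.iterate_succ_apply', heat_raiseP_mul, ih,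
      pderiv_conjPoly (by decide : (0 : Fin 2) ≠ 1), pderiv_one_raiseP_iterate' j hθ, conjPoly_mul,
      conjPoly_C, mul_left_comm (raiseP^[k] φ), heat_C_mul, ih, windowFactor, map_mul, conj_rtpi, C_mul]
    have e : ∀ a : ZPoly, C rtpi⁻¹ * (C rtpi * C (starRingEnd ℂ (j : ℂ)) * a) = C (j : ℂ) * a := by
      intro a
      rw [Complex.conj_natCast]
      linear_combination (C (j : ℂ) * a) * C_rtpi_inv_mul
    rw [e]
    ring

/-! ### The inverse of the heat operator -/

/-- The conjugate of multiplication by `X i` under the heat operator, where `{i, j} = {0, 1}`. -/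
def shiftX (i j : Fin 2) : Module.End ℂ ZPoly :=
  LinearMap.mulLeft ℂ (X i) - (Real.pi : ℂ)⁻¹ • (pderiv j).toLinearMap

theorem shiftX_apply (i j : Fin 2) (p : ZPoly) :
    shiftX i j p = X i * p - C (Real.pi : ℂ)⁻¹ * pderiv j p := by
  simp [shiftX, smul_eq_C_mul]

theorem heat_shiftX {i j : Fin 2} (h : i ≠ j) (p : ZPoly) :
    heat (shiftX i j p) = X i * heat p := by
  rw [shiftX_apply, heat_sub, heat_X_mul h, heat_C_mul]; ring

/-- This is what lets a new factor `X 1` pass the powers of `shiftX 0 1` in the definition of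
`heatInv`. -/
theorem shiftX_comm : Commute (shiftX 0 1) (shiftX 1 0) := by
  refine LinearMap.ext fun p => ?_
  simp only [Module.End.mul_apply, shiftX_apply, map_sub, pderiv_mul, pderiv_C, pderiv_X_self]
  rw [pderiv_comm]
  ring

/-- The operator `e^{-Δ/4π}`. -/
def heatInv : ZPoly →ₗ[ℂ] ZPoly :=
  (basisMonomials (Fin 2) ℂ).constr ℂ fun m => (shiftX 0 1 ^ m 0 * shiftX 1 0 ^ m 1) 1

theorem heatInv_monomial (m : Fin 2 →₀ ℕ) :
    heatInv (monomial m 1) = (shiftX 0 1 ^ m 0 * shiftX 1 0 ^ m 1) 1 := by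
  have := (basisMonomials (Fin 2) ℂ).constr_basis ℂ
    (fun m => (shiftX 0 1 ^ m 0 * shiftX 1 0 ^ m 1) (1 : ZPoly)) m
  rwa [coe_basisMonomials] at this

theorem heatInv_X_zero_mul (p : ZPoly) : heatInv (X 0 * p) = shiftX 0 1 (heatInv p) := by
  have : heatInv ∘ₗ LinearMap.mulLeft ℂ (X 0) = shiftX 0 1 ∘ₗ heatInv := by
    refine (basisMonomials (Fin 2) ℂ).ext fun m => ?_
    simp only [coe_basisMonomials, LinearMap.comp_apply, LinearMap.mulLeft_apply]
    rw [X, monomial_mul, one_mul, heatInv_monomial, heatInv_monomial, ← Module.End.mul_apply,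
      ← mul_assoc, ← pow_succ']
    simp [add_comm]
  exact LinearMap.congr_fun this p

theorem heatInv_X_one_mul (p : ZPoly) : heatInv (X 1 * p) = shiftX 1 0 (heatInv p) := by
  have : heatInv ∘ₗ LinearMap.mulLeft ℂ (X 1) = shiftX 1 0 ∘ₗ heatInv := by
    refine (basisMonomials (Fin 2) ℂ).ext fun m => ?_
    simp only [coe_basisMonomials, LinearMap.comp_apply, LinearMap.mulLeft_apply]
    rw [X, monomial_mul, one_mul, heatInv_monomial, heatInv_monomial, ← Module.End.mul_apply,
      ← mul_assoc, ← ((shiftX_comm.pow_left (m 0)).eq), mul_assoc, ← pow_succ']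
    simp [add_comm]
  exact LinearMap.congr_fun this p

theorem heatInv_one : heatInv 1 = 1 := by
  have := heatInv_monomial 0
  simpa using this

/-- `heat` carries the shifted multiplications back to the ordinary ones and fixes `1`, so the claim
propagates through products. Injectivity of `heat` then upgrades this right inverse to a two-sided
one. -/
theorem heat_heatInv (p : ZPoly) : heat (heatInv p) = p := by
  induction p using MvPolynomial.induction_on with
  | C a =>
    rw [← mul_one (C a), ← smul_eq_C_mul, map_smul, heatInv_one, smul_eq_C_mul, heat_C_mul,
      heat_one]
  | add p q hp hq => rw [map_add, heat_add, hp, hq]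
  | mul_X p i hp =>
    rw [mul_comm]
    fin_cases i
    · exact (congrArg heat (heatInv_X_zero_mul p)).trans
        ((heat_shiftX (by decide) _).trans (congrArg (X 0 * ·) hp))
    · exact (congrArg heat (heatInv_X_one_mul p)).trans
        ((heat_shiftX (by decide) _).trans (congrArg (X 1 * ·) hp))

theorem heatInv_heat (p : ZPoly) : heatInv (heat p) = p := by
  rw [← sub_eq_zero, ← heat_eq_zero, heat_sub, heat_heatInv, sub_self]

theorem map_conj_heat (p : ZPoly) : MvPolynomial.map (starRingEnd ℂ) (heat p) =
    heat (MvPolynomial.map (starRingEnd ℂ) p) := by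
  have hl : ∀ m, MvPolynomial.map (starRingEnd ℂ) ((lap ^ m) p) =
      (lap ^ m) (MvPolynomial.map (starRingEnd ℂ) p) := by
    intro m
    induction m with
    | zero => rfl
    | succ m ih =>
      rw [pow_succ', Module.End.mul_apply, Module.End.mul_apply, ← ih, lap_apply, lap_apply,
        pderiv_map, pderiv_map]
  rw [heat_eq_sum (p := p) (Nat.lt_succ_self _), heat_eq_sum (K := p.totalDegree + 1)
    (by rw [totalDegree_map_conj]; exact Nat.lt_succ_self _), map_sum]
  refine Finset.sum_congr rfl fun m _ => ?_
  rw [smul_eq_C_mul, smul_eq_C_mul, map_mul, map_C, hl]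
  simp [heatCoeff]

/-! ### Wirtinger calculus -/

/-- The real-linear map `v ↦ a v + b v̄`. -/
def wirt (a b : ℂ) : ℂ →L[ℝ] ℂ :=
  a • ContinuousLinearMap.id ℝ ℂ + b • (Complex.conjCLE : ℂ →L[ℝ] ℂ)

@[simp] theorem wirt_apply (a b v : ℂ) : wirt a b v = a * v + b * starRingEnd ℂ v := by
  simp [wirt]

/-- `f` is real differentiable at `z` with `∂_z f = a` and `∂_{z̄} f = b`. -/
def HasWirt (f : ℂ → ℂ) (a b z : ℂ) : Prop := HasFDerivAt f (wirt a b) z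

theorem HasWirt.dz {f : ℂ → ℂ} {a b z : ℂ} (h : HasWirt f a b z) : dz f z = a := by
  rw [PolyFock.dz, HasFDerivAt.fderiv h]
  simp
  linear_combination (b - a) / 2 * Complex.I_mul_I

theorem HasWirt.dzbar {f : ℂ → ℂ} {a b z : ℂ} (h : HasWirt f a b z) : dzbar f z = b := by
  rw [PolyFock.dzbar, HasFDerivAt.fderiv h]
  simp
  linear_combination (a - b) / 2 * Complex.I_mul_I

theorem hasWirt_of_differentiableAt {f : ℂ → ℂ} {z : ℂ} (h : DifferentiableAt ℝ f z) :
    HasWirt f (dz f z) (dzbar f z) z := by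
  refine h.hasFDerivAt.congr_fderiv (ContinuousLinearMap.ext fun v => ?_)
  have e : fderiv ℝ f z v = (v.re : ℂ) * fderiv ℝ f z 1 + (v.im : ℂ) * fderiv ℝ f z Complex.I := by
    conv_lhs => rw [show v = v.re • (1 : ℂ) + v.im • Complex.I by simp [Complex.re_add_im]]
    rw [map_add, map_smul, map_smul, Complex.real_smul, Complex.real_smul]
  have hv : v = v.re + v.im * Complex.I := (Complex.re_add_im v).symm
  have hv' : starRingEnd ℂ v = v.re - v.im * Complex.I := by
    apply Complex.ext <;> simp
  rw [wirt_apply, e, hv', dz, dzbar]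
  nth_rewrite 3 [hv]
  linear_combination (v.im * fderiv ℝ f z Complex.I) * Complex.I_mul_I

theorem HasWirt.differentiableAt {f : ℂ → ℂ} {a b z : ℂ} (h : HasWirt f a b z) :
    DifferentiableAt ℝ f z := HasFDerivAt.differentiableAt h

theorem HasWirt.congr {f : ℂ → ℂ} {a b a' b' z : ℂ} (h : HasWirt f a b z) (ha : a = a')
    (hb : b = b') : HasWirt f a' b' z := by rwa [← ha, ← hb]

theorem hasWirt_const (c z : ℂ) : HasWirt (fun _ => c) 0 0 z :=
  (hasFDerivAt_const c z).congr_fderiv (by ext; simp)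

theorem hasWirt_id (z : ℂ) : HasWirt (fun z => z) 1 0 z :=
  (hasFDerivAt_id z).congr_fderiv (by ext; simp)

theorem hasWirt_conj (z : ℂ) : HasWirt (fun z => starRingEnd ℂ z) 0 1 z :=
  (Complex.conjCLE : ℂ →L[ℝ] ℂ).hasFDerivAt.congr_fderiv (by ext; simp)

theorem HasWirt.add {f g : ℂ → ℂ} {a b c d z : ℂ} (hf : HasWirt f a b z) (hg : HasWirt g c d z) :
    HasWirt (fun z => f z + g z) (a + c) (b + d) z :=
  (HasFDerivAt.add hf hg).congr_fderiv
    (ContinuousLinearMap.ext fun v => by simp only [_root_.add_apply, wirt_apply]; ring)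

theorem HasWirt.sub {f g : ℂ → ℂ} {a b c d z : ℂ} (hf : HasWirt f a b z) (hg : HasWirt g c d z) :
    HasWirt (fun z => f z - g z) (a - c) (b - d) z :=
  (HasFDerivAt.sub hf hg).congr_fderiv
    (ContinuousLinearMap.ext fun v => by simp only [_root_.sub_apply, wirt_apply]; ring)

theorem HasWirt.mul {f g : ℂ → ℂ} {a b c d z : ℂ} (hf : HasWirt f a b z) (hg : HasWirt g c d z) :
    HasWirt (fun z => f z * g z) (a * g z + f z * c) (b * g z + f z * d) z :=
  (HasFDerivAt.mul hf hg).congr_fderiv (ContinuousLinearMap.ext fun v => by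
    simp only [_root_.add_apply, _root_.smul_apply, wirt_apply,
      smul_eq_mul]
    ring)

theorem HasWirt.const_mul {f : ℂ → ℂ} {a b z : ℂ} (c : ℂ) (hf : HasWirt f a b z) :
    HasWirt (fun z => c * f z) (c * a) (c * b) z :=
  ((hasWirt_const c z).mul hf).congr (by ring) (by ring)

theorem HasWirt.cexp {f : ℂ → ℂ} {a b z : ℂ} (hf : HasWirt f a b z) :
    HasWirt (fun z => Complex.exp (f z)) (a * Complex.exp (f z)) (b * Complex.exp (f z)) z :=
  (HasFDerivAt.cexp hf).congr_fderiv (ContinuousLinearMap.ext fun v => by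
    simp only [_root_.smul_apply, wirt_apply, smul_eq_mul]
    ring)

theorem HasWirt.conj {f : ℂ → ℂ} {a b z : ℂ} (hf : HasWirt f a b z) :
    HasWirt (fun z => starRingEnd ℂ (f z)) (starRingEnd ℂ b) (starRingEnd ℂ a) z :=
  ((Complex.conjCLE : ℂ →L[ℝ] ℂ).hasFDerivAt.comp z hf).congr_fderiv
    (ContinuousLinearMap.ext fun v => by simp [add_comm])

theorem HasWirt.comp_const_sub {f : ℂ → ℂ} {a b c z : ℂ} (hf : HasWirt f a b (c - z)) :
    HasWirt (fun z => f (c - z)) (-a) (-b) z :=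
  (HasFDerivAt.comp z hf ((hasWirt_const c z).sub (hasWirt_id z))).congr_fderiv
    (ContinuousLinearMap.ext fun v => by simp)

theorem hasWirt_of_hasDerivAt {f : ℂ → ℂ} {f' z : ℂ} (hf : HasDerivAt f f' z) :
    HasWirt f f' 0 z :=
  (hf.hasFDerivAt.restrictScalars ℝ).congr_fderiv
    (ContinuousLinearMap.ext fun v => by simp [mul_comm])

/-! ### Polynomial functions -/

@[simp] theorem polyFun_C (c z : ℂ) : polyFun (C c) z = c := by simp [polyFun]
@[simp] theorem polyFun_one (z : ℂ) : polyFun 1 z = 1 := by simp [polyFun]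
@[simp] theorem polyFun_zero (z : ℂ) : polyFun 0 z = 0 := by simp [polyFun]
@[simp] theorem polyFun_X_zero (z : ℂ) : polyFun (X 0) z = z := by simp [polyFun]
@[simp] theorem polyFun_X_one (z : ℂ) : polyFun (X 1) z = starRingEnd ℂ z := by simp [polyFun]
@[simp] theorem polyFun_add (p q : ZPoly) (z : ℂ) :
    polyFun (p + q) z = polyFun p z + polyFun q z := by simp [polyFun]
@[simp] theorem polyFun_sub (p q : ZPoly) (z : ℂ) :
    polyFun (p - q) z = polyFun p z - polyFun q z := by simp [polyFun]
@[simp] theorem polyFun_mul (p q : ZPoly) (z : ℂ) :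
    polyFun (p * q) z = polyFun p z * polyFun q z := by simp [polyFun]
@[simp] theorem polyFun_pow (p : ZPoly) (n : ℕ) (z : ℂ) :
    polyFun (p ^ n) z = polyFun p z ^ n := by simp [polyFun]
@[simp] theorem polyFun_smul (c : ℂ) (p : ZPoly) (z : ℂ) :
    polyFun (c • p) z = c * polyFun p z := by simp [polyFun, smul_eval]
theorem polyFun_sum {ι : Type*} (s : Finset ι) (p : ι → ZPoly) (z : ℂ) :
    polyFun (∑ i ∈ s, p i) z = ∑ i ∈ s, polyFun (p i) z := by simp [polyFun]

theorem hasWirt_polyFun (p : ZPoly) (z : ℂ) :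
    HasWirt (polyFun p) (polyFun (pderiv 0 p) z) (polyFun (pderiv 1 p) z) z := by
  induction p using MvPolynomial.induction_on with
  | C a => exact ((hasWirt_const a z).congr (by simp) (by simp)).congr_of_eventuallyEq
            (Filter.Eventually.of_forall fun z => by simp)
  | add p q hp hq =>
    exact ((hp.add hq).congr (by simp) (by simp)).congr_of_eventuallyEq
            (Filter.Eventually.of_forall fun z => by simp)
  | mul_X p i hp =>
    fin_cases i
    · exact ((hp.mul (hasWirt_id z)).congr (by simp; ring) (by simp; ring)).congr_of_eventuallyEq
            (Filter.Eventually.of_forall fun z => by simp)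
    · exact ((hp.mul (hasWirt_conj z)).congr (by simp; ring) (by simp; ring)).congr_of_eventuallyEq
            (Filter.Eventually.of_forall fun z => by simp)

theorem dz_polyFun (p : ZPoly) : dz (polyFun p) = polyFun (pderiv 0 p) :=
  funext fun z => (hasWirt_polyFun p z).dz

theorem dzbar_polyFun (p : ZPoly) : dzbar (polyFun p) = polyFun (pderiv 1 p) :=
  funext fun z => (hasWirt_polyFun p z).dzbar

theorem dzbar_iterate_polyFun (n : ℕ) (p : ZPoly) :
    dzbar^[n] (polyFun p) = polyFun ((pderiv 1)^[n] p) := by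
  induction n with
  | zero => rfl
  | succ n ih => rw [Function.iterate_succ_apply', ih, dzbar_polyFun,
      ← Function.iterate_succ_apply' (pderiv (1 : Fin 2))]

theorem raise_polyFun (p : ZPoly) : raise (polyFun p) = polyFun (raiseP p) := by
  funext z
  rw [raise, dz_polyFun, raiseP_apply, ← rtpi]
  simp
  ring

theorem raise_iterate_polyFun (n : ℕ) (p : ZPoly) :
    raise^[n] (polyFun p) = polyFun (raiseP^[n] p) := by
  induction n with
  | zero => rfl
  | succ n ih => rw [Function.iterate_succ_apply', ih, raise_polyFun,
      ← Function.iterate_succ_apply' raiseP]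

/-- The linear substitution `z = x + iy`, `z̄ = x - iy` is invertible over `ℂ` (`A` with inverse
`B`), and a polynomial vanishing at all real points `(x, y)` is zero. -/
theorem eq_zero_of_polyFun_eq_zero {p : ZPoly} (h : ∀ z, polyFun p z = 0) : p = 0 := by
  set A : ZPoly →ₐ[ℂ] ZPoly := aeval ![X 0 + C Complex.I * X 1, X 0 - C Complex.I * X 1]
  set B : ZPoly →ₐ[ℂ] ZPoly :=
    aeval ![C 2⁻¹ * (X 0 + X 1), C (-Complex.I / 2) * (X 0 - X 1)]
  have hBA : ∀ q, B (A q) = q := by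
    intro q
    have : B.comp A = AlgHom.id ℂ ZPoly := by
      refine MvPolynomial.algHom_ext fun i => ?_
      have h1 : (C Complex.I * C (-Complex.I / 2) : ZPoly) = C 2⁻¹ := by
        rw [← C_mul]; congr 1; linear_combination (-1 / 2) * Complex.I_mul_I
      have h2 : (C 2⁻¹ + C 2⁻¹ : ZPoly) = 1 := by
        rw [← C_add, ← C_1]; norm_num
      fin_cases i
      · simp [A, B, algHom_C, algebraMap_eq]
        linear_combination (X 0 - X 1) * h1 + X 0 * h2
      · simp [A, B, algHom_C, algebraMap_eq]
        linear_combination (X 1 - X 0) * h1 + X 1 * h2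
    exact DFunLike.congr_fun this q
  have hA : A p = 0 := by
    refine funext_set (fun _ => Set.range (fun x : ℝ => (x : ℂ)))
      (fun _ => Set.infinite_range_of_injective Complex.ofReal_injective) fun v hv => ?_
    obtain ⟨x, hx⟩ := hv 0 trivial
    obtain ⟨y, hy⟩ := hv 1 trivial
    have hE : ∀ q : ZPoly, eval v (A q) = polyFun q (x + y * Complex.I) := by
      intro q
      induction q using MvPolynomial.induction_on with
      | C a => simp [A, algHom_C, algebraMap_eq]
      | add p q hp hq => rw [map_add, map_add, hp, hq, polyFun_add]
      | mul_X p i hp =>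
        rw [map_mul, map_mul, hp, polyFun_mul]
        fin_cases i <;> simp [A, ← hx, ← hy, mul_comm, sub_eq_add_neg]
    rw [hE, h, map_zero]
  rw [← hBA p, hA, map_zero]

/-! ### Integration by parts on the plane -/

theorem integral_fderiv_apply_eq_zero {u : ℂ → ℂ} {v : ℂ} (hd : Differentiable ℝ u)
    (hu : Integrable u) (hv : Integrable fun z => fderiv ℝ u z v) :
    ∫ z, fderiv ℝ u z v = 0 := by
  have := integral_mul_fderiv_eq_neg_fderiv_mul_of_integrable (μ := volume)
    (f := fun _ : ℂ => (1 : ℂ)) (g := u) (v := v) (by simp) (by simpa using hv) (by simpa using hu)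
    (fun _ _ => differentiableAt_const _) (fun z _ => hd z)
  simpa using this

/-- The directional derivatives along `1` and `I` integrate to zero; these are two independent
linear equations for the integrals of `a` and `b`. -/
theorem integral_wirt_eq_zero {u a b : ℂ → ℂ} (hd : ∀ z, HasWirt u (a z) (b z) z)
    (hu : Integrable u) (ha : Integrable a) (hb : Integrable b) :
    ∫ z, a z = 0 ∧ ∫ z, b z = 0 := by
  have hf : ∀ z v, fderiv ℝ u z v = a z * v + b z * starRingEnd ℂ v := fun z v => by
    rw [HasFDerivAt.fderiv (hd z), wirt_apply]
  have hdiff : Differentiable ℝ u := fun z => (hd z).differentiableAt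
  have key : ∀ v : ℂ, (∫ z, a z) * v + (∫ z, b z) * starRingEnd ℂ v = 0 := fun v => by
    rw [← integral_mul_const, ← integral_mul_const, ← integral_add (ha.mul_const _)
      (hb.mul_const _), ← integral_fderiv_apply_eq_zero (v := v) hdiff hu]
    · simp_rw [hf]
    · simp_rw [hf]
      exact (ha.mul_const _).add (hb.mul_const _)
  have h1 := key 1
  have h2 := key Complex.I
  simp only [map_one, Complex.conj_I] at h1 h2
  constructor
  · linear_combination (1 / 2) * h1 - (Complex.I / 2) * h2 +
      (1 / 2) * ((∫ z, a z) - ∫ z, b z) * Complex.I_mul_I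
  · linear_combination (1 / 2) * h1 + (Complex.I / 2) * h2 -
      (1 / 2) * ((∫ z, a z) - ∫ z, b z) * Complex.I_mul_I

/-! ### Gaussian growth bounds -/

/-- `f` is `O(e^{c|z|²})`. -/
def ExpBound (c : ℝ) (f : ℂ → ℂ) : Prop := ∃ C : ℝ, 0 ≤ C ∧ ∀ z, ‖f z‖ ≤ C * Real.exp (c * ‖z‖ ^ 2)

theorem ExpBound.mul {c d : ℝ} {f g : ℂ → ℂ} (hf : ExpBound c f) (hg : ExpBound d g) :
    ExpBound (c + d) fun z => f z * g z := by
  obtain ⟨C, hC0, hC⟩ := hf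
  obtain ⟨D, hD0, hD⟩ := hg
  refine ⟨C * D, by positivity, fun z => ?_⟩
  rw [norm_mul, add_mul, Real.exp_add]
  calc _ ≤ (C * Real.exp (c * ‖z‖ ^ 2)) * (D * Real.exp (d * ‖z‖ ^ 2)) := by
        gcongr; exacts [hC z, hD z]
    _ = _ := by ring

theorem ExpBound.mono {c d : ℝ} {f : ℂ → ℂ} (hf : ExpBound c f) (h : c ≤ d) : ExpBound d f := by
  obtain ⟨C, hC0, hC⟩ := hf
  exact ⟨C, hC0, fun z => (hC z).trans (by gcongr)⟩

theorem ExpBound.add {c : ℝ} {f g : ℂ → ℂ} (hf : ExpBound c f) (hg : ExpBound c g) :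
    ExpBound c fun z => f z + g z := by
  obtain ⟨C, hC0, hC⟩ := hf
  obtain ⟨D, hD0, hD⟩ := hg
  refine ⟨C + D, by positivity, fun z => (norm_add_le _ _).trans ?_⟩
  rw [add_mul]
  exact add_le_add (hC z) (hD z)

theorem ExpBound.conj {c : ℝ} {f : ℂ → ℂ} (hf : ExpBound c f) :
    ExpBound c fun z => starRingEnd ℂ (f z) := by
  simpa only [ExpBound, RCLike.norm_conj] using hf

theorem expBound_of_bounded {f : ℂ → ℂ} {B : ℝ} (h : ∀ z, ‖f z‖ ≤ B) : ExpBound 0 f :=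
  ⟨B, (norm_nonneg _).trans (h 0), by simpa using h⟩

theorem mul_le_const_add_sq {c : ℝ} (hc : 0 < c) (A t : ℝ) : A * t ≤ A ^ 2 / (4 * c) + c * t ^ 2 := by
  have h : A ^ 2 / (4 * c) + c * t ^ 2 - A * t = (A - 2 * c * t) ^ 2 / (4 * c) := by
    field_simp; ring
  have h2 : 0 ≤ (A - 2 * c * t) ^ 2 / (4 * c) := by positivity
  linarith

theorem expBound_polyFun {c : ℝ} (hc : 0 < c) (p : ZPoly) : ExpBound c (polyFun p) := by
  have hid : ∀ {d : ℝ}, 0 < d → ExpBound d fun z => z := fun {d} hd =>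
    ⟨Real.exp (1 / (4 * d)), by positivity, fun z => by
      rw [← Real.exp_add]
      have h1 := mul_le_const_add_sq hd 1 ‖z‖
      have h2 := Real.add_one_le_exp (1 / (4 * d) + d * ‖z‖ ^ 2)
      norm_num at h1 h2 ⊢
      linarith⟩
  induction p using MvPolynomial.induction_on generalizing c with
  | C a => simpa [ExpBound] using (expBound_of_bounded (f := fun _ => a) (fun _ => le_rfl)).mono hc.le
  | add p q hp hq => simpa [ExpBound] using (hp hc).add (hq hc)
  | mul_X p i hp =>
    have h1 := hp (half_pos hc)
    fin_cases i
    · simpa [ExpBound] using h1.mul (hid (half_pos hc))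
    · simpa [ExpBound] using h1.mul (hid (half_pos hc)).conj

theorem expBound_cexp_linear {c : ℝ} (hc : 0 < c) (α β : ℂ) :
    ExpBound c fun z => Complex.exp (α * z + β * starRingEnd ℂ z) := by
  refine ⟨Real.exp ((‖α‖ + ‖β‖) ^ 2 / (4 * c)), by positivity, fun z => ?_⟩
  rw [Complex.norm_exp, ← Real.exp_add, Real.exp_le_exp]
  refine le_trans ?_ (mul_le_const_add_sq hc (‖α‖ + ‖β‖) ‖z‖)
  refine (Complex.re_le_norm _).trans ((norm_add_le _ _).trans ?_)
  rw [norm_mul, norm_mul, RCLike.norm_conj, add_mul]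

theorem norm_cexp_gauss (c : ℝ) (z : ℂ) :
    ‖Complex.exp ((c : ℂ) * (z * starRingEnd ℂ z))‖ = Real.exp (c * ‖z‖ ^ 2) := by
  rw [Complex.norm_exp, Complex.mul_conj, ← Complex.ofReal_mul, Complex.ofReal_re,
    Complex.normSq_eq_norm_sq]

theorem expBound_cexp_gauss (c : ℝ) :
    ExpBound c fun z => Complex.exp ((c : ℂ) * (z * starRingEnd ℂ z)) :=
  ⟨1, zero_le_one, fun z => by rw [norm_cexp_gauss, one_mul]⟩

theorem integrable_exp_neg_sq {c : ℝ} (hc : c < 0) :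
    Integrable fun z : ℂ => Real.exp (c * ‖z‖ ^ 2) := by
  have := (GaussianFourier.integrable_cexp_neg_mul_sq_norm_add (V := ℂ) (b := ((-c : ℝ) : ℂ))
    (by simpa using hc) 0 0).norm
  refine this.congr (Filter.Eventually.of_forall fun z => ?_)
  simp only [Complex.norm_exp]
  congr 1
  simp [← Complex.ofReal_pow, ← Complex.ofReal_mul]

theorem ExpBound.integrable {c : ℝ} {f : ℂ → ℂ} (hf : ExpBound c f) (hc : c < 0)
    (hm : AEStronglyMeasurable f) : Integrable f := by
  obtain ⟨C, -, hC⟩ := hf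
  exact ((integrable_exp_neg_sq hc).const_mul C).mono' hm (Filter.Eventually.of_forall hC)

/-! ### The Gaussian measure -/

theorem exp_gauss_eq (z : ℂ) : ((Real.exp (-Real.pi * ‖z‖ ^ 2) : ℝ) : ℂ) =
    Complex.exp (((-Real.pi : ℝ) : ℂ) * (z * starRingEnd ℂ z)) := by
  rw [Complex.mul_conj, Complex.normSq_eq_norm_sq]
  push_cast
  rfl

theorem integral_gauss (f : ℂ → ℂ) : ∫ z, f z ∂gauss =
    ∫ z, f z * Complex.exp (((-Real.pi : ℝ) : ℂ) * (z * starRingEnd ℂ z)) := by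
  rw [gauss, integral_withDensity_eq_integral_smul (by fun_prop)]
  refine integral_congr_ae (Filter.Eventually.of_forall fun z => ?_)
  simp only [NNReal.smul_def, Complex.real_smul, Real.coe_toNNReal _ (Real.exp_pos _).le,
    exp_gauss_eq, mul_comm]

theorem integrable_gauss_iff {f : ℂ → ℂ} : Integrable f gauss ↔
    Integrable fun z => f z * Complex.exp (((-Real.pi : ℝ) : ℂ) * (z * starRingEnd ℂ z)) := by
  rw [gauss, integrable_withDensity_iff_integrable_coe_smul (by fun_prop)]
  refine integrable_congr (Filter.Eventually.of_forall fun z => ?_)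
  simp only [Complex.real_smul, Real.coe_toNNReal _ (Real.exp_pos _).le,
    exp_gauss_eq, mul_comm]

theorem volume_absolutelyContinuous_gauss : (volume : Measure ℂ) ≪ gauss := by
  refine withDensity_absolutelyContinuous' (by fun_prop) (Filter.Eventually.of_forall fun z => ?_)
  simpa using Real.exp_pos _

instance : SFinite gauss := by unfold gauss; infer_instance

theorem polyFun_injective_ae {p q : ZPoly} (h : polyFun p =ᵐ[gauss] polyFun q) : p = q := by
  have h1 := volume_absolutelyContinuous_gauss.ae_eq h
  have h2 := (Continuous.ae_eq_iff_eq volume (continuous_polyFun p) (continuous_polyFun q)).1 h1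
  rw [← sub_eq_zero]
  exact eq_zero_of_polyFun_eq_zero fun z => by rw [polyFun_sub, h2, sub_self]

/-! ### Gaussian integrals of polynomials -/

/-- The weight `e^{αz + βz̄ - π|z|²}`. -/
def expWeight (α β z : ℂ) : ℂ :=
  Complex.exp (α * z + β * starRingEnd ℂ z) *
    Complex.exp (((-Real.pi : ℝ) : ℂ) * (z * starRingEnd ℂ z))

theorem expWeight_eq (α β z : ℂ) : expWeight α β z =
    Complex.exp (α * z + β * starRingEnd ℂ z - Real.pi * (z * starRingEnd ℂ z)) := by
  rw [expWeight, ← Complex.exp_add]; push_cast; ring_nf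

theorem continuous_conj' : Continuous fun z : ℂ => starRingEnd ℂ z := Complex.continuous_conj

theorem continuous_expWeight (α β : ℂ) : Continuous (expWeight α β) := by
  have := continuous_conj'
  unfold expWeight
  fun_prop

theorem expBound_expWeight (α β : ℂ) : ExpBound (-2) (expWeight α β) :=
  ((expBound_cexp_linear one_pos α β).mul (expBound_cexp_gauss _)).mono
    (by linarith [Real.pi_gt_three])

theorem expBound_polyFun_mul_expWeight (p : ZPoly) (α β : ℂ) :
    ExpBound (-1) fun z => polyFun p z * expWeight α β z :=
  ((expBound_polyFun one_pos p).mul (expBound_expWeight α β)).mono (by norm_num)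

theorem integrable_polyFun_mul_expWeight (p : ZPoly) (α β : ℂ) :
    Integrable fun z => polyFun p z * expWeight α β z :=
  (expBound_polyFun_mul_expWeight p α β).integrable (by norm_num)
    ((continuous_polyFun p).mul (continuous_expWeight α β)).aestronglyMeasurable

theorem hasWirt_polyFun_mul_expWeight (p : ZPoly) (α β z : ℂ) :
    HasWirt (fun z => polyFun p z * expWeight α β z)
      (polyFun (pderiv 0 p + C α * p - C (Real.pi : ℂ) * (X 1 * p)) z * expWeight α β z)
      (polyFun (pderiv 1 p + C β * p - C (Real.pi : ℂ) * (X 0 * p)) z * expWeight α β z) z := by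
  have h := (((hasWirt_id z).const_mul α).add ((hasWirt_conj z).const_mul β)).sub
    (((hasWirt_id z).mul (hasWirt_conj z)).const_mul (Real.pi : ℂ))
  have h2 := (hasWirt_polyFun p z).mul h.cexp
  simp only [expWeight_eq]
  exact h2.congr (by simp; ring) (by simp; ring)

/-- The integral `∫ p(z, z̄) e^{αz + βz̄ - π|z|²} d²z`. -/
def gaussInt (p : ZPoly) (α β : ℂ) : ℂ := ∫ z, polyFun p z * expWeight α β z

theorem gaussInt_pderiv (p : ZPoly) (α β : ℂ) :
    gaussInt (pderiv 0 p + C α * p - C (Real.pi : ℂ) * (X 1 * p)) α β = 0 ∧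
    gaussInt (pderiv 1 p + C β * p - C (Real.pi : ℂ) * (X 0 * p)) α β = 0 :=
  integral_wirt_eq_zero (hasWirt_polyFun_mul_expWeight p α β)
    (integrable_polyFun_mul_expWeight _ α β) (integrable_polyFun_mul_expWeight _ α β)
    (integrable_polyFun_mul_expWeight _ α β)

theorem gaussInt_add (p q : ZPoly) (α β : ℂ) :
    gaussInt (p + q) α β = gaussInt p α β + gaussInt q α β := by
  rw [gaussInt, gaussInt, gaussInt, ← integral_add (integrable_polyFun_mul_expWeight _ α β)
    (integrable_polyFun_mul_expWeight _ α β)]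
  simp_rw [polyFun_add, add_mul]

theorem gaussInt_C_mul (c : ℂ) (p : ZPoly) (α β : ℂ) :
    gaussInt (C c * p) α β = c * gaussInt p α β := by
  rw [gaussInt, gaussInt, ← integral_const_mul]
  simp_rw [polyFun_mul, polyFun_C, mul_assoc]

theorem gaussInt_sub (p q : ZPoly) (α β : ℂ) :
    gaussInt (p - q) α β = gaussInt p α β - gaussInt q α β := by
  have := gaussInt_add (p - q) q α β
  rw [sub_add_cancel] at this
  rw [this]; ring

/-- In real coordinates `αz + βz̄ = (α + β)x + i(α - β)y`, and the squares of these two coefficients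
add up to `4αβ`. -/
theorem gaussInt_one (α β : ℂ) : gaussInt 1 α β = Complex.exp (α * β / Real.pi) := by
  have h := GaussianFourier.integral_cexp_neg_mul_sum_add (b := (Real.pi : ℂ))
    (by simpa using Real.pi_pos) ![α + β, Complex.I * (α - β)]
  rw [← Complex.volume_preserving_equiv_pi.integral_comp
    Complex.measurableEquivPi.measurableEmbedding] at h
  rw [gaussInt]
  have e : ((∑ i, ![α + β, Complex.I * (α - β)] i ^ 2) / (4 * (Real.pi : ℂ)))
      = α * β / Real.pi := by
    have := pi_ne_zero'
    simp only [Fin.sum_univ_two, Matrix.cons_val_zero, Matrix.cons_val_one]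
    field_simp
    linear_combination (α - β) ^ 2 * Complex.I_sq
  rw [e, div_self pi_ne_zero', Complex.one_cpow, one_mul] at h
  rw [← h]
  refine integral_congr_ae (Filter.Eventually.of_forall fun z => ?_)
  simp only [polyFun_one, one_mul, expWeight_eq, Complex.measurableEquivPi_apply, Fin.sum_univ_two,
    Matrix.cons_val_zero, Matrix.cons_val_one]
  congr 1
  have hz : z = z.re + z.im * Complex.I := (Complex.re_add_im z).symm
  have hz' : starRingEnd ℂ z = z.re - z.im * Complex.I := by
    apply Complex.ext <;> simp
  rw [hz']
  linear_combination (α - Real.pi * (z.re - z.im * Complex.I)) * hz + Real.pi * z.im ^ 2 * Complex.I_sq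

/-! ### Growth of square-integrable entire functions -/

theorem integral_circle_eq {Φ : ℂ → ℂ} (h : Differentiable ℂ Φ) (z : ℂ) (r : ℝ) :
    ∫ θ in Set.Ioo (-Real.pi) Real.pi, Φ (z + Complex.polarCoord.symm (r, θ)) =
      (2 * Real.pi) • Φ z := by
  have h1 : Real.circleAverage Φ z r = Φ z := DiffContOnCl.circleAverage h.diffContOnCl
  rw [Real.circleAverage_eq_integral_add (-Real.pi),
    intervalIntegral.integral_comp_add_right (fun θ => Φ (circleMap z r θ))] at h1
  rw [← integral_Ioc_eq_integral_Ioo, ← intervalIntegral.integral_of_le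
    (by linarith [Real.pi_pos]), ← h1, smul_inv_smul₀ (by positivity)]
  have e : 2 * Real.pi + -Real.pi = Real.pi := by ring
  rw [zero_add, e]
  refine intervalIntegral.integral_congr fun θ _ => ?_
  simp only [circleMap, Complex.polarCoord_symm_apply, Complex.exp_mul_I, Complex.ofReal_cos,
    Complex.ofReal_sin]

theorem integral_ball_eq {Φ : ℂ → ℂ} (h : Differentiable ℂ Φ) (z : ℂ) :
    ∫ w in Metric.ball (0 : ℂ) 1, Φ (z + w) = Real.pi • Φ z := by
  rw [← integral_indicator measurableSet_ball, ← Complex.integral_comp_polarCoord_symm,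
    polarCoord_target]
  have e1 : ∀ p ∈ Set.Ioi (0 : ℝ) ×ˢ Set.Ioo (-Real.pi) Real.pi,
      p.1 • (Metric.ball (0 : ℂ) 1).indicator (fun w => Φ (z + w)) (Complex.polarCoord.symm p) =
      (Set.Iio (1 : ℝ) ×ˢ (Set.univ : Set ℝ)).indicator
        (fun p : ℝ × ℝ => p.1 • Φ (z + Complex.polarCoord.symm p)) p := by
    rintro ⟨r, θ⟩ ⟨hr, hθ⟩
    have hr' : |r| = r := abs_of_pos hr
    by_cases hr1 : r < 1
    · rw [Set.indicator_of_mem, Set.indicator_of_mem]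
      · exact ⟨hr1, trivial⟩
      · rw [mem_ball_zero_iff, Complex.norm_polarCoord_symm, hr']; exact hr1
    · rw [Set.indicator_of_notMem, Set.indicator_of_notMem, smul_zero]
      · exact fun h => hr1 h.1
      · rw [mem_ball_zero_iff, Complex.norm_polarCoord_symm, hr']; exact hr1
  rw [setIntegral_congr_fun (measurableSet_Ioi.prod measurableSet_Ioo) e1,
    setIntegral_indicator (measurableSet_Iio.prod MeasurableSet.univ), Set.prod_inter_prod,
    Set.inter_univ, Set.Ioi_inter_Iio, Measure.volume_eq_prod, setIntegral_prod]
  · simp_rw [integral_smul, integral_circle_eq h]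
    rw [← integral_Ioc_eq_integral_Ioo, ← intervalIntegral.integral_of_le zero_le_one,
      intervalIntegral.integral_smul_const, integral_id, smul_smul]
    congr 1
    ring
  · have hc : Continuous fun p : ℝ × ℝ => p.1 • Φ (z + Complex.polarCoord.symm p) := by
      have := h.continuous
      simp only [Complex.polarCoord_symm_apply]
      fun_prop
    refine (hc.continuousOn.integrableOn_compact
      (isCompact_Icc (a := (0 : ℝ)) (b := 1) |>.prod
        (isCompact_Icc (a := -Real.pi) (b := Real.pi)))).mono_set ?_
    exact Set.prod_mono Set.Ioo_subset_Icc_self Set.Ioo_subset_Icc_self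

/-- The mean value property over the unit disc about `z` bounds `Φ z` by an integral of `‖Φ‖`. There
`t ≤ 1 + t²`, applied to `t = ‖Φ‖ e^{-π|·|²/2}`, brings in the finite Gaussian `L²` integral. -/
theorem norm_le_of_memLp {Φ : ℂ → ℂ} (h : Differentiable ℂ Φ) (h2 : MemLp Φ 2 gauss) :
    ∃ A : ℝ, 0 ≤ A ∧ ∀ z, ‖Φ z‖ ≤ A * Real.exp (Real.pi / 2 * (‖z‖ + 1) ^ 2) := by
  have hI : Integrable fun z : ℂ => ‖Φ z‖ ^ 2 * Real.exp (-Real.pi * ‖z‖ ^ 2) := by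
    have h3 := (memLp_two_iff_integrable_sq_norm h2.1).1 h2
    rw [gauss, integrable_withDensity_iff_integrable_coe_smul (by fun_prop)] at h3
    refine h3.congr (Filter.Eventually.of_forall fun z => ?_)
    simp only [smul_eq_mul, Real.coe_toNNReal _ (Real.exp_pos _).le, mul_comm]
  set S : ℝ := ∫ z : ℂ, ‖Φ z‖ ^ 2 * Real.exp (-Real.pi * ‖z‖ ^ 2)
  have hS : 0 ≤ S := integral_nonneg fun z => by positivity
  set V : ℝ := ∫ _ in Metric.ball (0 : ℂ) 1, (1 : ℝ)
  have hV : 0 ≤ V := integral_nonneg fun z => zero_le_one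
  refine ⟨(V + S) / Real.pi, by positivity, fun z => ?_⟩
  set E := Real.exp (Real.pi / 2 * (‖z‖ + 1) ^ 2)
  have hc := h.continuous
  have hI' : Integrable fun w : ℂ => ‖Φ (z + w)‖ ^ 2 * Real.exp (-Real.pi * ‖z + w‖ ^ 2) :=
    hI.comp_add_left z
  have hpt : ∀ w ∈ Metric.ball (0 : ℂ) 1, ‖Φ (z + w)‖ ≤
      E * (1 + ‖Φ (z + w)‖ ^ 2 * Real.exp (-Real.pi * ‖z + w‖ ^ 2)) := by
    intro w hw
    rw [mem_ball_zero_iff] at hw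
    have hn : ‖z + w‖ ≤ ‖z‖ + 1 := (norm_add_le _ _).trans (by linarith)
    set t := ‖Φ (z + w)‖ * Real.exp (-(Real.pi / 2 * ‖z + w‖ ^ 2)) with ht
    have ht2 : t ^ 2 = ‖Φ (z + w)‖ ^ 2 * Real.exp (-Real.pi * ‖z + w‖ ^ 2) := by
      rw [ht, mul_pow, ← Real.exp_nat_mul]; congr 2; push_cast; ring
    have h1 : ‖Φ (z + w)‖ = t * Real.exp (Real.pi / 2 * ‖z + w‖ ^ 2) := by
      rw [ht, mul_assoc, ← Real.exp_add, neg_add_cancel, Real.exp_zero, mul_one]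
    have ht0 : 0 ≤ t := by positivity
    rw [← ht2]
    calc ‖Φ (z + w)‖ = t * Real.exp (Real.pi / 2 * ‖z + w‖ ^ 2) := h1
      _ ≤ (1 + t ^ 2) * E := by
        have hπ := Real.pi_pos
        have hE : Real.exp (Real.pi / 2 * ‖z + w‖ ^ 2) ≤ E := Real.exp_le_exp.2 (by gcongr)
        gcongr
        nlinarith [sq_nonneg (t - 1)]
      _ = _ := mul_comm _ _
  have hbound : ‖Real.pi • Φ z‖ ≤ E * (V + S) := by
    rw [← integral_ball_eq h z]
    have hint1 : IntegrableOn (fun _ : ℂ => (1 : ℝ)) (Metric.ball (0 : ℂ) 1) := by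
      rw [integrableOn_const_iff]; right; exact measure_ball_lt_top
    calc ‖∫ w in Metric.ball (0 : ℂ) 1, Φ (z + w)‖
        ≤ ∫ w in Metric.ball (0 : ℂ) 1, ‖Φ (z + w)‖ := norm_integral_le_integral_norm _
      _ ≤ ∫ w in Metric.ball (0 : ℂ) 1,
            E * (1 + ‖Φ (z + w)‖ ^ 2 * Real.exp (-Real.pi * ‖z + w‖ ^ 2)) := by
          refine setIntegral_mono_on ?_ ((hint1.add hI'.integrableOn).const_mul E)
            measurableSet_ball hpt
          have : Continuous fun w => ‖Φ (z + w)‖ := by fun_prop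
          exact (this.continuousOn.integrableOn_compact
            (isCompact_closedBall (0 : ℂ) 1)).mono_set Metric.ball_subset_closedBall
      _ = E * (V + ∫ w in Metric.ball (0 : ℂ) 1,
            ‖Φ (z + w)‖ ^ 2 * Real.exp (-Real.pi * ‖z + w‖ ^ 2)) := by
          rw [integral_const_mul, integral_add hint1 hI'.integrableOn]
      _ ≤ E * (V + S) := by
          gcongr
          refine (setIntegral_le_integral hI' (Filter.Eventually.of_forall fun w => by
            positivity)).trans (le_of_eq ?_)
          exact integral_add_left_eq_self
            (fun w : ℂ => ‖Φ w‖ ^ 2 * Real.exp (-Real.pi * ‖w‖ ^ 2)) z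
  rw [norm_smul, Real.norm_of_nonneg Real.pi_pos.le] at hbound
  rw [div_mul_eq_mul_div, le_div_iff₀ Real.pi_pos]
  linarith

/-- Entire functions all of whose derivatives are `O(e^{3π|z|²/4})`. -/
def FockGrowth (Φ : ℂ → ℂ) : Prop :=
  Differentiable ℂ Φ ∧ ∀ i : ℕ, ExpBound (3 / 4 * Real.pi) (iteratedDeriv i Φ)

theorem FockGrowth.deriv {Φ : ℂ → ℂ} (h : FockGrowth Φ) : FockGrowth (deriv Φ) :=
  ⟨h.1.deriv, fun i => by rw [← iteratedDeriv_succ']; exact h.2 (i + 1)⟩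

theorem fockGrowth_of_memLp {Φ : ℂ → ℂ} (h : Differentiable ℂ Φ) (h2 : MemLp Φ 2 gauss) :
    FockGrowth Φ := by
  obtain ⟨A, hA0, hA⟩ := norm_le_of_memLp h h2
  have hπ := Real.pi_pos
  refine ⟨h, fun i => ⟨i.factorial * A * Real.exp (6 * Real.pi), by positivity, fun z => ?_⟩⟩
  have h1 := Complex.norm_iteratedDeriv_le_of_forall_mem_sphere_norm_le (c := z) (R := 1) (f := Φ)
    (C := A * Real.exp (Real.pi / 2 * (‖z‖ + 2) ^ 2)) i one_pos h.diffContOnCl (fun w hw => by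
      refine (hA w).trans ?_
      have hw' : ‖w‖ ≤ ‖z‖ + 1 := by
        rw [mem_sphere_iff_norm] at hw
        have := norm_sub_norm_le w z
        linarith
      exact mul_le_mul_of_nonneg_left (Real.exp_le_exp.2 (mul_le_mul_of_nonneg_left
        (pow_le_pow_left₀ (by positivity) (by linarith) 2) (by positivity))) hA0)
  refine h1.trans ?_
  rw [one_pow, div_one, mul_assoc, mul_assoc, ← Real.exp_add]
  gcongr
  -- With `t = ‖z‖`, the difference `6π + (3/4)π t² - (π/2)(t + 2)²` equals `(π/4)(t - 4)²`; this
  -- fixes the constant `6π`.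
  nlinarith [mul_nonneg hπ.le (sq_nonneg (‖z‖ - 4))]

/-- Sums of products of polynomials in `z, z̄` and entire functions of controlled growth. -/
inductive PolyGrowth : (ℂ → ℂ) → Prop
  | mul (p : ZPoly) (Φ : ℂ → ℂ) (h : FockGrowth Φ) : PolyGrowth fun z => polyFun p z * Φ z
  | add (f g : ℂ → ℂ) (hf : PolyGrowth f) (hg : PolyGrowth g) : PolyGrowth fun z => f z + g z

theorem FockGrowth.polyGrowth {Φ : ℂ → ℂ} (h : FockGrowth Φ) : PolyGrowth Φ := by
  simpa using PolyGrowth.mul 1 Φ h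

theorem PolyGrowth.differentiableAt {g : ℂ → ℂ} (h : PolyGrowth g) (z : ℂ) :
    DifferentiableAt ℝ g z := by
  induction h with
  | mul p Φ h =>
    exact ((hasWirt_polyFun p z).mul (hasWirt_of_hasDerivAt (h.1 z).hasDerivAt)).differentiableAt
  | add f g _ _ hf hg => exact hf.add hg

theorem PolyGrowth.hasWirt {g : ℂ → ℂ} (h : PolyGrowth g) (z : ℂ) :
    HasWirt g (PolyFock.dz g z) (PolyFock.dzbar g z) z :=
  hasWirt_of_differentiableAt (h.differentiableAt z)

theorem PolyGrowth.continuous {g : ℂ → ℂ} (h : PolyGrowth g) : Continuous g :=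
  continuous_iff_continuousAt.2 fun z => (h.differentiableAt z).continuousAt

/-- The polynomial factor costs `π/8` on top of `3π/4`. Staying strictly below `π` leaves room for
another polynomial when integrating against `dμ`. -/
theorem PolyGrowth.expBound {g : ℂ → ℂ} (h : PolyGrowth g) : ExpBound (7 / 8 * Real.pi) g := by
  have hπ := Real.pi_pos
  induction h with
  | mul p Φ h =>
    exact ((expBound_polyFun (by positivity : 0 < Real.pi / 8) p).mul (h.2 0)).mono (by linarith)
  | add f g _ _ hf hg => exact hf.add hg

theorem PolyGrowth.polyFun_mul {g : ℂ → ℂ} (h : PolyGrowth g) (q : ZPoly) :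
    PolyGrowth fun z => polyFun q z * g z := by
  induction h with
  | mul p Φ h => simpa [mul_assoc] using PolyGrowth.mul (q * p) Φ h
  | add f g _ _ hf hg => simpa [mul_add] using PolyGrowth.add _ _ hf hg

theorem PolyGrowth.dz {g : ℂ → ℂ} (h : PolyGrowth g) : PolyGrowth (dz g) := by
  induction h with
  | mul p Φ h =>
    have e : PolyFock.dz (fun z => polyFun p z * Φ z) =
        fun z => polyFun (pderiv 0 p) z * Φ z + polyFun p z * _root_.deriv Φ z :=
      funext fun z => ((hasWirt_polyFun p z).mul (hasWirt_of_hasDerivAt (h.1 z).hasDerivAt)).dz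
    rw [e]
    exact .add _ _ (.mul _ _ h) (.mul _ _ h.deriv)
  | add f g hf hg ihf ihg =>
    have e : PolyFock.dz (fun z => f z + g z) = fun z => PolyFock.dz f z + PolyFock.dz g z :=
      funext fun z => ((hf.hasWirt z).add (hg.hasWirt z)).dz
    rw [e]
    exact .add _ _ ihf ihg

theorem PolyGrowth.raise {g : ℂ → ℂ} (h : PolyGrowth g) : PolyGrowth (raise g) := by
  have := PolyGrowth.add _ _ (h.polyFun_mul (C rtpi * X 1)) (h.dz.polyFun_mul (C (-rtpi⁻¹)))
  have e : PolyFock.raise g = fun z => polyFun (C rtpi * X 1) z * g z +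
      polyFun (C (-rtpi⁻¹)) z * PolyFock.dz g z := by
    funext z
    rw [PolyFock.raise, ← rtpi, PolyFock.polyFun_mul, polyFun_C, polyFun_C, polyFun_X_one]
    ring
  rwa [e]

theorem PolyGrowth.raise_iterate {g : ℂ → ℂ} (h : PolyGrowth g) (k : ℕ) :
    PolyGrowth (PolyFock.raise^[k] g) := by
  induction k with
  | zero => exact h
  | succ k ih => rw [Function.iterate_succ_apply']; exact ih.raise

theorem PolyGrowth.dzbar {g : ℂ → ℂ} (h : PolyGrowth g) : PolyGrowth (dzbar g) := by
  induction h with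
  | mul p Φ h =>
    have e : PolyFock.dzbar (fun z => polyFun p z * Φ z) =
        fun z => polyFun (pderiv 1 p) z * Φ z :=
      funext fun z => (((hasWirt_polyFun p z).mul
        (hasWirt_of_hasDerivAt (h.1 z).hasDerivAt)).congr rfl (by ring)).dzbar
    rw [e]
    exact .mul _ _ h
  | add f g hf hg ihf ihg =>
    have e : PolyFock.dzbar (fun z => f z + g z) =
        fun z => PolyFock.dzbar f z + PolyFock.dzbar g z :=
      funext fun z => ((hf.hasWirt z).add (hg.hasWirt z)).dzbar
    rw [e]
    exact .add _ _ ihf ihg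

theorem PolyGrowth.integrable {g : ℂ → ℂ} (h : PolyGrowth g) (q : ZPoly) :
    Integrable fun z => polyFun q z * starRingEnd ℂ (g z) *
      Complex.exp (((-Real.pi : ℝ) : ℂ) * (z * starRingEnd ℂ z)) := by
  have hπ := Real.pi_pos
  refine (((expBound_polyFun (by positivity : 0 < Real.pi / 16) q).mul h.expBound.conj).mul
    (expBound_cexp_gauss (-Real.pi))).integrable (by linarith) ?_
  have := h.continuous
  have := continuous_polyFun q
  have := continuous_conj'
  exact Continuous.aestronglyMeasurable (by fun_prop)

/-! ### Adjointness of raising and lowering -/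

theorem hasWirt_gauss (z : ℂ) :
    HasWirt (fun z => Complex.exp (((-Real.pi : ℝ) : ℂ) * (z * starRingEnd ℂ z)))
      (-Real.pi * starRingEnd ℂ z * Complex.exp (((-Real.pi : ℝ) : ℂ) * (z * starRingEnd ℂ z)))
      (-Real.pi * z * Complex.exp (((-Real.pi : ℝ) : ℂ) * (z * starRingEnd ℂ z))) z :=
  (((hasWirt_id z).mul (hasWirt_conj z)).const_mul _).cexp.congr (by simp) (by simp)

theorem integral_wirt_polyGrowth {g : ℂ → ℂ} (h : PolyGrowth g) (q : ZPoly) :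
    (∫ z, polyFun (pderiv 0 q - C (Real.pi : ℂ) * X 1 * q) z * starRingEnd ℂ (g z) ∂gauss) +
      ∫ z, polyFun q z * starRingEnd ℂ (dzbar g z) ∂gauss = 0 ∧
    (∫ z, polyFun (pderiv 1 q - C (Real.pi : ℂ) * X 0 * q) z * starRingEnd ℂ (g z) ∂gauss) +
      ∫ z, polyFun q z * starRingEnd ℂ (dz g z) ∂gauss = 0 := by
  have h2 := integral_wirt_eq_zero (fun z => (((hasWirt_polyFun q z).mul
    (h.hasWirt z).conj).mul (hasWirt_gauss z)).congr
    (a' := polyFun (pderiv 0 q - C (Real.pi : ℂ) * X 1 * q) z * starRingEnd ℂ (g z) *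
      Complex.exp (((-Real.pi : ℝ) : ℂ) * (z * starRingEnd ℂ z)) +
      polyFun q z * starRingEnd ℂ (dzbar g z) *
      Complex.exp (((-Real.pi : ℝ) : ℂ) * (z * starRingEnd ℂ z)))
    (b' := polyFun (pderiv 1 q - C (Real.pi : ℂ) * X 0 * q) z * starRingEnd ℂ (g z) *
      Complex.exp (((-Real.pi : ℝ) : ℂ) * (z * starRingEnd ℂ z)) +
      polyFun q z * starRingEnd ℂ (dz g z) *
      Complex.exp (((-Real.pi : ℝ) : ℂ) * (z * starRingEnd ℂ z)))
    (by simp; ring) (by simp; ring)) (h.integrable q)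
    ((h.integrable _).add (h.dzbar.integrable q)) ((h.integrable _).add (h.dz.integrable q))
  rw [integral_add (h.integrable _) (h.dzbar.integrable q),
    integral_add (h.integrable _) (h.dz.integrable q)] at h2
  simpa only [integral_gauss] using h2

theorem PolyGrowth.integrable_gauss {g : ℂ → ℂ} (h : PolyGrowth g) (q : ZPoly) :
    Integrable (fun z => polyFun q z * starRingEnd ℂ (g z)) gauss :=
  integrable_gauss_iff.2 (h.integrable q)

theorem ip_raise_right {g : ℂ → ℂ} (h : PolyGrowth g) (q : ZPoly) :
    ip (polyFun q) (raise g) = ip (polyFun (lowerP q)) g := by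
  have h1 := (integral_wirt_polyGrowth h q).2
  have e1 : ∀ z, polyFun q z * starRingEnd ℂ (raise g z) = polyFun (lowerP q) z *
      starRingEnd ℂ (g z) - rtpi⁻¹ * (polyFun (pderiv 1 q - C (Real.pi : ℂ) * X 0 * q) z *
        starRingEnd ℂ (g z) + polyFun q z * starRingEnd ℂ (dz g z)) := by
    intro z
    rw [raise, ← rtpi, lowerP_apply]
    simp only [map_sub, map_mul, map_inv₀, conj_rtpi, polyFun_mul,
      polyFun_sub, polyFun_C, polyFun_X_zero, Complex.conj_conj, ← rtpi_mul_self]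
    have := rtpi_ne_zero
    field_simp
    ring
  simp only [ip]
  simp_rw [e1]
  have hi : Integrable (fun z => polyFun (pderiv 1 q - C (Real.pi : ℂ) * X 0 * q) z *
      starRingEnd ℂ (g z) + polyFun q z * starRingEnd ℂ (dz g z)) gauss :=
    (h.integrable_gauss _).add (h.dz.integrable_gauss _)
  rw [integral_sub (h.integrable_gauss _) (hi.const_mul _), integral_const_mul,
    integral_add (h.integrable_gauss _) (h.dz.integrable_gauss _), h1, mul_zero, sub_zero]

/-- Against the Gaussian weight, `R q` is `-(1/√π) ∂_z (q e^{-π|z|²})`; integrating by parts puts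
`∂_z` on `conj Φ`, which it kills. -/
theorem ip_raise_left {Φ : ℂ → ℂ} (h : FockGrowth Φ) (q : ZPoly) :
    ip (polyFun (raiseP q)) Φ = 0 := by
  have h1 := (integral_wirt_polyGrowth h.polyGrowth q).1
  have e0 : dzbar Φ = fun _ => 0 :=
    funext fun z => (hasWirt_of_hasDerivAt (h.1 z).hasDerivAt).dzbar
  rw [e0] at h1
  simp only [map_zero, mul_zero, integral_zero, add_zero] at h1
  have e1 : ∀ z, polyFun (raiseP q) z * starRingEnd ℂ (Φ z) = -rtpi⁻¹ *
      (polyFun (pderiv 0 q - C (Real.pi : ℂ) * X 1 * q) z * starRingEnd ℂ (Φ z)) := by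
    intro z
    rw [raiseP_apply]
    simp only [polyFun_mul, polyFun_sub, polyFun_C, polyFun_X_one, ← rtpi_mul_self]
    have := rtpi_ne_zero
    field_simp
    ring
  simp only [ip]
  simp_rw [e1]
  rw [integral_const_mul, h1, mul_zero]

theorem ip_raise_iterate_right {g : ℂ → ℂ} (h : PolyGrowth g) (k : ℕ) (q : ZPoly) :
    ip (polyFun q) (raise^[k] g) = ip (polyFun (lowerP^[k] q)) g := by
  induction k generalizing q with
  | zero => rfl
  | succ k ih =>
    rw [Function.iterate_succ_apply', ip_raise_right (h.raise_iterate k), ih,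
      ← Function.iterate_succ_apply lowerP]

theorem ip_smul_left (c : ℂ) (q : ZPoly) (g : ℂ → ℂ) :
    ip (polyFun (c • q)) g = c * ip (polyFun q) g := by
  simp only [ip, polyFun_smul, mul_assoc, integral_const_mul]

/-- Move all `k` raisings to the left as lowerings. If `k < l`, a raised polynomial remains and is
orthogonal to the entire function; if `k > l`, the lowerings annihilate `R^l φ`. -/
theorem ip_raise_iterate_eq_zero {φ : ZPoly} (hφ : pderiv 1 φ = 0) {Φ : ℂ → ℂ} (h : FockGrowth Φ)
    {k l : ℕ} (hkl : k ≠ l) : ip (polyFun (raiseP^[l] φ)) (raise^[k] Φ) = 0 := by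
  rw [ip_raise_iterate_right h.polyGrowth, lowerP_iterate_raiseP_iterate l k hφ, ip_smul_left]
  rcases lt_or_gt_of_ne hkl with h1 | h1
  · obtain ⟨m, hm⟩ := Nat.exists_eq_succ_of_ne_zero (Nat.sub_ne_zero_of_lt h1)
    rw [hm, Function.iterate_succ_apply', ip_raise_left h, mul_zero]
  · rw [Nat.descFactorial_of_lt h1, Nat.cast_zero, zero_mul]

/-! ### The orthogonal projections of polynomials -/

/-- Polynomials as elements of `L²(ℂ, dμ)`. -/
def polyL2 : ZPoly →ₗ[ℂ] Lp ℂ 2 gauss where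
  toFun p := (memLp_polyFun p).toLp (polyFun p)
  map_add' p q := by
    rw [← MemLp.toLp_add]
    exact MemLp.toLp_congr _ _ (Filter.Eventually.of_forall fun z => by simp)
  map_smul' c p := by
    rw [RingHom.id_apply, ← MemLp.toLp_const_smul]
    exact MemLp.toLp_congr _ _ (Filter.Eventually.of_forall fun z => by simp)

theorem coeFn_polyL2 (p : ZPoly) : polyL2 p =ᵐ[gauss] polyFun p :=
  MemLp.coeFn_toLp (memLp_polyFun p)

theorem repPoly_polyL2 (p : ZPoly) : repPoly (polyL2 p) = p := by
  have h : ∃ q : ZPoly, polyL2 p =ᵐ[gauss] polyFun q := ⟨p, coeFn_polyL2 p⟩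
  rw [repPoly, dif_pos h]
  exact polyFun_injective_ae (h.choose_spec.symm.trans (coeFn_polyL2 p))

theorem differentiable_polyFun {φ : ZPoly} (hφ : pderiv 1 φ = 0) :
    Differentiable ℂ (polyFun φ) := fun z => by
  have h := hasWirt_polyFun φ z
  rw [hφ, polyFun_zero] at h
  exact (hasFDerivAt_of_restrictScalars ℝ
    (f' := polyFun (pderiv 0 φ) z • ContinuousLinearMap.id ℂ ℂ) h
    (by ext; simp)).differentiableAt

theorem polyL2_mem_trueFock {φ : ZPoly} (hφ : pderiv 1 φ = 0) (k : ℕ) :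
    polyL2 (raiseP^[k] φ) ∈ trueFock k := by
  refine Submodule.le_topologicalClosure _ (Submodule.subset_span ?_)
  set c : ℂ := (Real.sqrt (k.factorial : ℝ) : ℂ)
  have hc : c ≠ 0 := by
    have : 0 < Real.sqrt (k.factorial : ℝ) := Real.sqrt_pos.2 (by exact_mod_cast k.factorial_pos)
    simpa only [c] using (by exact_mod_cast this.ne')
  have hcφ : pderiv 1 (c • φ) = 0 := by rw [Derivation.map_smul, hφ, smul_zero]
  -- Scaling by `c = √(k!)` compensates the normalization in `trueFock`.
  refine ⟨polyFun (c • φ), differentiable_polyFun hcφ, memLp_polyFun _, ?_⟩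
  refine (coeFn_polyL2 _).trans (Filter.Eventually.of_forall fun z => ?_)
  have e : raiseP^[k] (c • φ) = c • raiseP^[k] φ := by
    rw [← Module.End.pow_apply, map_smul, Module.End.pow_apply]
  simp only [raise_iterate_polyFun, e, polyFun_smul]
  rw [inv_mul_cancel_left₀ hc]

theorem polyL2_mem_orthogonal {φ : ZPoly} (hφ : pderiv 1 φ = 0) {k l : ℕ} (hkl : k ≠ l) :
    polyL2 (raiseP^[l] φ) ∈ (trueFock k)ᗮ := by
  -- An orthogonal complement is a closed subspace, so only the generators of `trueFock k` need
  -- checking.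
  have hle : trueFock k ≤ (Submodule.span ℂ {polyL2 (raiseP^[l] φ)})ᗮ := by
    refine Submodule.topologicalClosure_minimal _ (Submodule.span_le.2 ?_)
      (Submodule.isClosed_orthogonal _)
    rintro f ⟨Φ, hΦ, hΦ2, hf⟩
    rw [SetLike.mem_coe, Submodule.mem_orthogonal_singleton_iff_inner_left, L2.inner_def]
    have h0 := ip_raise_iterate_eq_zero hφ (fockGrowth_of_memLp hΦ hΦ2) hkl
    have e : (fun a => inner ℂ (f a) (polyL2 (raiseP^[l] φ) a)) =ᵐ[gauss] fun z =>
        (Real.sqrt (k.factorial : ℝ) : ℂ)⁻¹ *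
          (polyFun (raiseP^[l] φ) z * starRingEnd ℂ (raise^[k] Φ z)) := by
      filter_upwards [hf, coeFn_polyL2 (raiseP^[l] φ)] with z h1 h2
      rw [h1, h2, RCLike.inner_apply, map_mul, map_inv₀, Complex.conj_ofReal]
      ring
    rw [integral_congr_ae e, integral_const_mul]
    rw [ip] at h0
    rw [h0, mul_zero]
  rw [Submodule.mem_orthogonal]
  intro u hu
  exact (Submodule.mem_orthogonal_singleton_iff_inner_left).1 (hle hu)

/-- The `k`-th term lies in `trueFock k` and the remaining terms are orthogonal to it, which
characterizes the projection. In particular it is a polynomial, so `repPoly` does not take its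
default value. -/
theorem proj_sum_raise {φ : ℕ → ZPoly} (hφ : ∀ k, pderiv 1 (φ k) = 0) {N k : ℕ} (hk : k < N) :
    proj k (∑ i ∈ Finset.range N, raiseP^[i] (φ i)) = raiseP^[k] (φ k) := by
  have h : (trueFock k).starProjection (polyL2 (∑ i ∈ Finset.range N, raiseP^[i] (φ i))) =
      polyL2 (raiseP^[k] (φ k)) := by
    refine Submodule.eq_starProjection_of_mem_orthogonal (polyL2_mem_trueFock (hφ k) k) ?_
    rw [← Finset.add_sum_erase _ _ (Finset.mem_range.2 hk), map_add, add_sub_cancel_left, map_sum]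
    exact Submodule.sum_mem _ fun i hi =>
      polyL2_mem_orthogonal (hφ i) (Finset.ne_of_mem_erase hi).symm
  have e : proj k (∑ i ∈ Finset.range N, raiseP^[i] (φ i)) =
    repPoly ((trueFock k).starProjection
      (polyL2 (∑ i ∈ Finset.range N, raiseP^[i] (φ i)))) := rfl
  rw [e, h, repPoly_polyL2]

theorem exists_proj_eq_raise {n : ℕ} {Ψ : ZPoly} (h : polyFun Ψ ∈ polyFock n) :
    ∃ φ : ℕ → ZPoly, (∀ k, pderiv 1 (φ k) = 0) ∧ (∀ k ≤ n, proj k Ψ = raiseP^[k] (φ k)) ∧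
      Ψ = ∑ k : Fin (n + 1), raiseP^[k] (φ k) := by
  obtain ⟨φ, h1, h2⟩ := exists_raise_decomposition (n + 1) Ψ
    (eq_zero_of_polyFun_eq_zero fun z => by rw [← dzbar_iterate_polyFun]; exact h.2.2 z)
  refine ⟨φ, h1, fun k hk => ?_, ?_⟩
  · rw [h2, proj_sum_raise h1 (Nat.lt_succ_of_le hk)]
  · rw [h2, Finset.sum_range]

/-! ### Symbols in `BC^∞` -/

theorem BCInf.fderiv_apply {σ : ℂ → ℂ} (h : BCInf σ) (v : ℂ) :
    BCInf fun z => fderiv ℝ σ z v := by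
  have h1 : ContDiff ℝ (⊤ : ℕ∞) (fderiv ℝ σ) := h.1.fderiv_right (by simp)
  refine ⟨h1.clm_apply contDiff_const, fun m => ?_⟩
  obtain ⟨C, hC⟩ := h.2 (m + 1)
  refine ⟨‖v‖ * C, fun z => ?_⟩
  refine (norm_iteratedFDeriv_clm_apply_const (N := (⊤ : ℕ∞)) h1.contDiffAt
    (by exact_mod_cast le_top)).trans ?_
  rw [norm_iteratedFDeriv_fderiv]
  exact mul_le_mul_of_nonneg_left (hC z) (norm_nonneg v)

theorem BCInf.add {σ τ : ℂ → ℂ} (h : BCInf σ) (h' : BCInf τ) : BCInf fun z => σ z + τ z := by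
  refine ⟨h.1.add h'.1, fun m => ?_⟩
  obtain ⟨C, hC⟩ := h.2 m
  obtain ⟨D, hD⟩ := h'.2 m
  refine ⟨C + D, fun z => ?_⟩
  have e := iteratedFDeriv_add_apply (i := m) (x := z)
    (h.1.contDiffAt.of_le (by exact_mod_cast le_top))
    (h'.1.contDiffAt.of_le (by exact_mod_cast le_top))
  have e' : iteratedFDeriv ℝ m (fun z => σ z + τ z) z =
    iteratedFDeriv ℝ m σ z + iteratedFDeriv ℝ m τ z := e
  rw [e']
  exact (norm_add_le _ _).trans (add_le_add (hC z) (hD z))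

theorem BCInf.const_mul {σ : ℂ → ℂ} (h : BCInf σ) (c : ℂ) : BCInf fun z => c * σ z := by
  refine ⟨contDiff_const.mul h.1, fun m => ?_⟩
  obtain ⟨C, hC⟩ := h.2 m
  refine ⟨‖c‖ * C, fun z => ?_⟩
  have e := iteratedFDeriv_const_smul_apply (i := m) (x := z) (a := c)
    (h.1.contDiffAt.of_le (by exact_mod_cast le_top) : ContDiffAt ℝ m σ z)
  have e' : iteratedFDeriv ℝ m (fun z => c * σ z) z = c • iteratedFDeriv ℝ m σ z := e
  rw [e', norm_smul]
  exact mul_le_mul_of_nonneg_left (hC z) (norm_nonneg c)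

theorem BCInf.dz {σ : ℂ → ℂ} (h : BCInf σ) : BCInf (dz σ) := by
  have e : PolyFock.dz σ = fun z => (1 / 2) * fderiv ℝ σ z 1 +
      (-Complex.I / 2) * fderiv ℝ σ z Complex.I := by
    funext z; rw [PolyFock.dz]; ring
  rw [e]
  exact ((h.fderiv_apply 1).const_mul _).add ((h.fderiv_apply Complex.I).const_mul _)

theorem BCInf.dzbar {σ : ℂ → ℂ} (h : BCInf σ) : BCInf (dzbar σ) := by
  have e : PolyFock.dzbar σ = fun z => (1 / 2) * fderiv ℝ σ z 1 +
      (Complex.I / 2) * fderiv ℝ σ z Complex.I := by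
    funext z; rw [PolyFock.dzbar]; ring
  rw [e]
  exact ((h.fderiv_apply 1).const_mul _).add ((h.fderiv_apply Complex.I).const_mul _)

theorem BCInf.dz_iterate {σ : ℂ → ℂ} (h : BCInf σ) (n : ℕ) : BCInf (PolyFock.dz^[n] σ) := by
  induction n with
  | zero => exact h
  | succ n ih => rw [Function.iterate_succ_apply']; exact ih.dz

theorem BCInf.dzbar_iterate {σ : ℂ → ℂ} (h : BCInf σ) (n : ℕ) :
    BCInf (PolyFock.dzbar^[n] σ) := by
  induction n with
  | zero => exact h
  | succ n ih => rw [Function.iterate_succ_apply']; exact ih.dzbar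

theorem BCInf.bounded {σ : ℂ → ℂ} (h : BCInf σ) : ∃ B, ∀ z, ‖σ z‖ ≤ B := by
  obtain ⟨C, hC⟩ := h.2 0
  exact ⟨C, fun z => by simpa using hC z⟩

theorem BCInf.continuous {σ : ℂ → ℂ} (h : BCInf σ) : Continuous σ := h.1.continuous

theorem BCInf.hasWirt {σ : ℂ → ℂ} (h : BCInf σ) (z : ℂ) :
    HasWirt σ (PolyFock.dz σ z) (PolyFock.dzbar σ z) z :=
  hasWirt_of_differentiableAt (h.1.differentiable (by simp) z)

/-! ### The kernel of the Berezin-Toeplitz operators -/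

/-- The function `z ↦ conj ((W_z Ψ)(ζ')) (W_z Θ)(ζ)`. -/
def weylKernel (Ψ Θ : ZPoly) (ζ ζ' z : ℂ) : ℂ :=
  starRingEnd ℂ (weyl z (polyFun Ψ) ζ') * weyl z (polyFun Θ) ζ

theorem weyl_eq (z ζ : ℂ) (f : ℂ → ℂ) : weyl z f ζ =
    Complex.exp (Real.pi * starRingEnd ℂ z * ζ - Real.pi / 2 * (z * starRingEnd ℂ z)) *
      f (ζ - z) := by
  rw [weyl, Complex.mul_conj, Complex.normSq_eq_norm_sq]
  push_cast
  rfl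

theorem conj_weyl_eq (z ζ : ℂ) (f : ℂ → ℂ) : starRingEnd ℂ (weyl z f ζ) =
    Complex.exp (Real.pi * z * starRingEnd ℂ ζ - Real.pi / 2 * (z * starRingEnd ℂ z)) *
      starRingEnd ℂ (f (ζ - z)) := by
  rw [weyl_eq, map_mul, ← Complex.exp_conj]
  have h2 : starRingEnd ℂ (2 : ℂ) = 2 := Complex.conj_ofNat 2
  simp [Complex.conj_ofReal, mul_comm z, h2]

theorem weylKernel_eq (Ψ Θ : ZPoly) (ζ ζ' z : ℂ) : weylKernel Ψ Θ ζ ζ' z =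
    starRingEnd ℂ (polyFun Ψ (ζ' - z)) * polyFun Θ (ζ - z) *
      expWeight (Real.pi * starRingEnd ℂ ζ') (Real.pi * ζ) z := by
  have e : expWeight (Real.pi * starRingEnd ℂ ζ') (Real.pi * ζ) z =
      Complex.exp (Real.pi * z * starRingEnd ℂ ζ' - Real.pi / 2 * (z * starRingEnd ℂ z)) *
      Complex.exp (Real.pi * starRingEnd ℂ z * ζ - Real.pi / 2 * (z * starRingEnd ℂ z)) := by
    rw [expWeight_eq, ← Complex.exp_add]
    ring_nf
  rw [weylKernel, conj_weyl_eq, weyl_eq, e]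
  ring

theorem continuous_weyl (p : ZPoly) : Continuous fun x : ℂ × ℂ => weyl x.1 (polyFun p) x.2 := by
  have := continuous_conj'
  have := continuous_polyFun p
  simp only [weyl_eq]
  fun_prop

theorem norm_weyl (z ζ : ℂ) (f : ℂ → ℂ) : ‖weyl z f ζ‖ =
    ‖f (ζ - z)‖ * Real.exp (Real.pi / 2 * ‖ζ‖ ^ 2 - Real.pi / 2 * ‖ζ - z‖ ^ 2) := by
  rw [weyl, norm_mul, mul_comm, Complex.norm_exp]
  congr 2
  simp only [Complex.sq_norm, Complex.normSq_apply, Complex.sub_re, Complex.sub_im,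
    Complex.ofReal_re, Complex.mul_re, Complex.mul_im, Complex.ofReal_im, Complex.conj_re,
    Complex.conj_im]
  ring

theorem exists_norm_weyl_le (p : ZPoly) : ∃ C, 0 ≤ C ∧ ∀ z ζ, ‖weyl z (polyFun p) ζ‖ ≤
    C * Real.exp (Real.pi / 2 * ‖ζ‖ ^ 2 - Real.pi / 4 * ‖ζ - z‖ ^ 2) := by
  obtain ⟨C, hC0, hC⟩ := expBound_polyFun (by positivity : 0 < Real.pi / 4) p
  refine ⟨C, hC0, fun z ζ => ?_⟩
  rw [norm_weyl]
  refine (mul_le_mul_of_nonneg_right (hC (ζ - z)) (Real.exp_pos _).le).trans (le_of_eq ?_)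
  rw [mul_assoc, ← Real.exp_add]
  ring_nf

theorem norm_sq_le_two_mul (a b : ℂ) : ‖a‖ ^ 2 ≤ 2 * ‖a - b‖ ^ 2 + 2 * ‖b‖ ^ 2 := by
  have h : ‖a‖ ≤ ‖a - b‖ + ‖b‖ := by simpa using norm_add_le (a - b) b
  nlinarith [sq_nonneg (‖a - b‖ - ‖b‖), norm_nonneg a]

/-- Part of the decay in `ζ' - z` and `ζ - z` is traded for decay in `z` and for a rate in `ζ'`
below `π/2`. With `15π/32 < π/2` the `ζ'` factor is square-integrable for `dμ` and can be paired
with any `F` in `L²`. -/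
theorem exists_norm_weylKernel_le (Ψ Θ : ZPoly) (ζ : ℂ) : ∃ C, 0 ≤ C ∧ ∀ ζ' z,
    ‖weylKernel Ψ Θ ζ ζ' z‖ ≤ C * (Real.exp (-(Real.pi / 16) * ‖z‖ ^ 2) *
      Real.exp (15 / 32 * Real.pi * ‖ζ'‖ ^ 2)) := by
  obtain ⟨A, hA0, hA⟩ := exists_norm_weyl_le Ψ
  obtain ⟨B, hB0, hB⟩ := exists_norm_weyl_le Θ
  have hπ := Real.pi_pos
  refine ⟨A * B * Real.exp (3 / 4 * Real.pi * ‖ζ‖ ^ 2), by positivity, fun ζ' z => ?_⟩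
  rw [weylKernel, norm_mul, RCLike.norm_conj]
  refine (mul_le_mul (hA z ζ') (hB z ζ) (norm_nonneg _) (by positivity)).trans ?_
  rw [mul_mul_mul_comm, mul_assoc (A * B), ← Real.exp_add, ← Real.exp_add, ← Real.exp_add]
  refine mul_le_mul_of_nonneg_left (Real.exp_le_exp.2 ?_) (by positivity)
  have h1 := norm_sq_le_two_mul ζ' z
  have h2 := norm_sq_le_two_mul z ζ
  rw [norm_sub_rev z ζ] at h2
  have h3 : 0 ≤ ‖ζ' - z‖ ^ 2 := by positivity
  have h4 : 0 ≤ ‖ζ‖ ^ 2 := by positivity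
  nlinarith [mul_le_mul_of_nonneg_left h1 hπ.le, mul_le_mul_of_nonneg_left h2 hπ.le,
    mul_nonneg hπ.le h3, mul_nonneg hπ.le h4]

/-- The integrand of the Berezin-Toeplitz operator as a function of `(z, ζ')`. -/
def btIntegrand (σ : ℂ → ℂ) (Ψ Θ : ZPoly) (F : ℂ → ℂ) (ζ : ℂ) (x : ℂ × ℂ) : ℂ :=
  σ x.1 * F x.2 * weylKernel Ψ Θ ζ x.2 x.1

theorem integrable_norm_mul_exp {F : ℂ → ℂ} (hF : MemLp F 2 gauss) :
    Integrable (fun ζ => ‖F ζ‖ * Real.exp (15 / 32 * Real.pi * ‖ζ‖ ^ 2)) gauss := by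
  have hE : MemLp (fun ζ : ℂ => Real.exp (15 / 32 * Real.pi * ‖ζ‖ ^ 2)) 2 gauss := by
    refine (memLp_two_iff_integrable_sq_norm
      (Continuous.aestronglyMeasurable (by fun_prop))).2 ?_
    rw [gauss, integrable_withDensity_iff_integrable_coe_smul (by fun_prop)]
    refine (integrable_exp_neg_sq (c := -(Real.pi / 16)) (by linarith [Real.pi_pos])).congr
      (Filter.Eventually.of_forall fun z => ?_)
    simp only [smul_eq_mul, Real.coe_toNNReal _ (Real.exp_pos _).le,
      Real.norm_of_nonneg (Real.exp_pos _).le, ← Real.exp_nat_mul, ← Real.exp_add]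
    congr 1
    push_cast
    ring
  exact MemLp.integrable_mul hF.norm hE

theorem integrable_btIntegrand {σ F : ℂ → ℂ} (hσ : BCInf σ) (hF : MemLp F 2 gauss)
    (Ψ Θ : ZPoly) (ζ : ℂ) : Integrable (btIntegrand σ Ψ Θ F ζ) (volume.prod gauss) := by
  obtain ⟨B, hB⟩ := hσ.bounded
  obtain ⟨C, hC0, hC⟩ := exists_norm_weylKernel_le Ψ Θ ζ
  have hB0 : 0 ≤ B := (norm_nonneg _).trans (hB 0)
  have hdom := ((integrable_exp_neg_sq (c := -(Real.pi / 16))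
    (by linarith [Real.pi_pos])).mul_prod (integrable_norm_mul_exp hF)).const_mul (B * C)
  refine hdom.mono' ?_ (Filter.Eventually.of_forall fun x => ?_)
  · have h1 : Continuous fun x : ℂ × ℂ => weylKernel Ψ Θ ζ x.2 x.1 := by
      unfold weylKernel
      exact (continuous_conj'.comp (continuous_weyl Ψ)).mul
        ((continuous_weyl Θ).comp (continuous_fst.prodMk continuous_const))
    exact (((hσ.continuous.comp continuous_fst).aestronglyMeasurable).mul
      hF.1.comp_snd).mul h1.aestronglyMeasurable
  · rw [btIntegrand, norm_mul, norm_mul]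
    calc _ ≤ (B * ‖F x.2‖) * (C * (Real.exp (-(Real.pi / 16) * ‖x.1‖ ^ 2) *
          Real.exp (15 / 32 * Real.pi * ‖x.2‖ ^ 2))) := by
          gcongr
          exacts [hB _, hC _ _]
      _ = _ := by ring

theorem berezinToeplitz_eq {σ F : ℂ → ℂ} (hσ : BCInf σ) (hF : MemLp F 2 gauss)
    (Ψ Θ : ZPoly) (ζ : ℂ) : berezinToeplitz σ (polyFun Ψ) (polyFun Θ) F ζ =
      ∫ x, btIntegrand σ Ψ Θ F ζ x ∂(volume.prod gauss) := by
  rw [integral_prod _ (integrable_btIntegrand hσ hF Ψ Θ ζ), berezinToeplitz]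
  refine integral_congr_ae (Filter.Eventually.of_forall fun z => ?_)
  simp only [ip, btIntegrand, weylKernel]
  rw [← integral_const_mul, ← integral_mul_const]
  refine integral_congr_ae (Filter.Eventually.of_forall fun ζ' => ?_)
  simp only
  ring

theorem weylKernel_add_left (Ψ Ψ' Θ : ZPoly) (ζ ζ' z : ℂ) : weylKernel (Ψ + Ψ') Θ ζ ζ' z =
    weylKernel Ψ Θ ζ ζ' z + weylKernel Ψ' Θ ζ ζ' z := by
  simp only [weylKernel_eq, polyFun_add, map_add]; ring

theorem weylKernel_add_right (Ψ Θ Θ' : ZPoly) (ζ ζ' z : ℂ) : weylKernel Ψ (Θ + Θ') ζ ζ' z =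
    weylKernel Ψ Θ ζ ζ' z + weylKernel Ψ Θ' ζ ζ' z := by
  simp only [weylKernel_eq, polyFun_add]; ring

theorem weylKernel_smul_left (c : ℂ) (Ψ Θ : ZPoly) (ζ ζ' z : ℂ) :
    weylKernel (c • Ψ) Θ ζ ζ' z = starRingEnd ℂ c * weylKernel Ψ Θ ζ ζ' z := by
  simp only [weylKernel_eq, polyFun_smul, map_mul]; ring

theorem weylKernel_smul_right (c : ℂ) (Ψ Θ : ZPoly) (ζ ζ' z : ℂ) :
    weylKernel Ψ (c • Θ) ζ ζ' z = c * weylKernel Ψ Θ ζ ζ' z := by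
  simp only [weylKernel_eq, polyFun_smul]; ring

theorem berezinToeplitz_add_left {σ F : ℂ → ℂ} (hσ : BCInf σ) (hF : MemLp F 2 gauss) (ζ : ℂ)
    (Ψ Ψ' Θ : ZPoly) :
    berezinToeplitz σ (polyFun (Ψ + Ψ')) (polyFun Θ) F ζ =
      berezinToeplitz σ (polyFun Ψ) (polyFun Θ) F ζ +
      berezinToeplitz σ (polyFun Ψ') (polyFun Θ) F ζ := by
  simp only [berezinToeplitz_eq hσ hF]
  rw [← integral_add (integrable_btIntegrand hσ hF _ _ _) (integrable_btIntegrand hσ hF _ _ _)]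
  simp only [btIntegrand, weylKernel_add_left, mul_add]

theorem berezinToeplitz_add_right {σ F : ℂ → ℂ} (hσ : BCInf σ) (hF : MemLp F 2 gauss) (ζ : ℂ)
    (Ψ Θ Θ' : ZPoly) :
    berezinToeplitz σ (polyFun Ψ) (polyFun (Θ + Θ')) F ζ =
      berezinToeplitz σ (polyFun Ψ) (polyFun Θ) F ζ +
      berezinToeplitz σ (polyFun Ψ) (polyFun Θ') F ζ := by
  simp only [berezinToeplitz_eq hσ hF]
  rw [← integral_add (integrable_btIntegrand hσ hF _ _ _) (integrable_btIntegrand hσ hF _ _ _)]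
  simp only [btIntegrand, weylKernel_add_right, mul_add]

theorem berezinToeplitz_smul_left {σ F : ℂ → ℂ} (hσ : BCInf σ) (hF : MemLp F 2 gauss) (ζ : ℂ)
    (c : ℂ) (Ψ Θ : ZPoly) :
    berezinToeplitz σ (polyFun (c • Ψ)) (polyFun Θ) F ζ =
      starRingEnd ℂ c * berezinToeplitz σ (polyFun Ψ) (polyFun Θ) F ζ := by
  simp only [berezinToeplitz_eq hσ hF]
  rw [← integral_const_mul]
  simp only [btIntegrand, weylKernel_smul_left, mul_left_comm]

theorem berezinToeplitz_smul_right {σ F : ℂ → ℂ} (hσ : BCInf σ) (hF : MemLp F 2 gauss) (ζ : ℂ)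
    (c : ℂ) (Ψ Θ : ZPoly) :
    berezinToeplitz σ (polyFun Ψ) (polyFun (c • Θ)) F ζ =
      c * berezinToeplitz σ (polyFun Ψ) (polyFun Θ) F ζ := by
  simp only [berezinToeplitz_eq hσ hF]
  rw [← integral_const_mul]
  simp only [btIntegrand, weylKernel_smul_right, mul_left_comm]

theorem berezinToeplitz_const_mul_symbol {σ F : ℂ → ℂ} (hσ : BCInf σ) (hF : MemLp F 2 gauss) (ζ : ℂ)
    (c : ℂ) (Ψ Θ : ZPoly) :
    berezinToeplitz (fun z => c * σ z) (polyFun Ψ) (polyFun Θ) F ζ =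
      c * berezinToeplitz σ (polyFun Ψ) (polyFun Θ) F ζ := by
  rw [berezinToeplitz_eq hσ hF, berezinToeplitz_eq (hσ.const_mul c) hF, ← integral_const_mul]
  simp only [btIntegrand, mul_assoc]

theorem berezinToeplitz_add_symbol {σ τ F : ℂ → ℂ} (hσ : BCInf σ) (hτ : BCInf τ)
    (hF : MemLp F 2 gauss) (ζ : ℂ) (Ψ Θ : ZPoly) :
    berezinToeplitz (fun z => σ z + τ z) (polyFun Ψ) (polyFun Θ) F ζ =
      berezinToeplitz σ (polyFun Ψ) (polyFun Θ) F ζ +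
      berezinToeplitz τ (polyFun Ψ) (polyFun Θ) F ζ := by
  rw [berezinToeplitz_eq hσ hF, berezinToeplitz_eq hτ hF, berezinToeplitz_eq (hσ.add hτ) hF,
    ← integral_add (integrable_btIntegrand hσ hF _ _ _) (integrable_btIntegrand hτ hF _ _ _)]
  simp only [btIntegrand, add_mul]

/-! ### Integration by parts in the symbol -/

/-- The operator `π z - ∂_{z̄}` on polynomials. -/
def multP (p : ZPoly) : ZPoly := C (Real.pi : ℂ) * (X 0 * p) - pderiv 1 p

/-- The commutators of `πz` with `-(1/√π) ∂_z` and of `-∂_{z̄}` with `√π z̄` cancel. -/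
theorem multP_raiseP (p : ZPoly) : multP (raiseP p) = raiseP (multP p) := by
  rw [multP, pderiv_one_raiseP, multP, raiseP_apply, map_sub, raiseP_apply, raiseP_apply,
    pderiv_C_mul, pderiv_mul, pderiv_X_self, ← C_rtpi_mul_self]
  linear_combination (C rtpi * p) * C_rtpi_inv_mul

theorem multP_raiseP_iterate (k : ℕ) {φ : ZPoly} (h : pderiv 1 φ = 0) :
    multP (raiseP^[k] φ) = (Real.pi : ℂ) • raiseP^[k] (X 0 * φ) := by
  have h1 : ∀ p, multP (raiseP^[k] p) = raiseP^[k] (multP p) := by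
    intro p
    induction k with
    | zero => rfl
    | succ k ih =>
      rw [Function.iterate_succ_apply', multP_raiseP, ih, ← Function.iterate_succ_apply' raiseP]
  rw [h1, multP, h, sub_zero, ← smul_eq_C_mul, ← Module.End.pow_apply, map_smul,
    Module.End.pow_apply]

/-- Differentiating the exponential in `z` gives `π conj (ζ' - z)` after absorbing `-πz̄`, that is,
multiplication of the window `Ψ` by `πz` before conjugation. The derivative is therefore again a
combination of kernels with polynomial windows. -/
theorem hasWirt_weylKernel (Ψ Θ : ZPoly) (ζ ζ' z : ℂ) : HasWirt (weylKernel Ψ Θ ζ ζ')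
    (weylKernel (multP Ψ) Θ ζ ζ' z - weylKernel Ψ (pderiv 0 Θ) ζ ζ' z)
    (weylKernel Ψ (multP Θ) ζ ζ' z - weylKernel (pderiv 0 Ψ) Θ ζ ζ' z) z := by
  have hE := hasWirt_polyFun_mul_expWeight 1 (Real.pi * starRingEnd ℂ ζ') (Real.pi * ζ) z
  simp only [polyFun_one, one_mul] at hE
  have h := ((hasWirt_polyFun Ψ (ζ' - z)).comp_const_sub.conj.mul
    (hasWirt_polyFun Θ (ζ - z)).comp_const_sub).mul hE
  have e : weylKernel Ψ Θ ζ ζ' = fun z => starRingEnd ℂ (polyFun Ψ (ζ' - z)) *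
      polyFun Θ (ζ - z) * expWeight (Real.pi * starRingEnd ℂ ζ') (Real.pi * ζ) z :=
    funext (weylKernel_eq Ψ Θ ζ ζ')
  rw [e]
  refine h.congr ?_ ?_
  · simp [weylKernel_eq, multP]; ring
  · simp [weylKernel_eq, multP]; ring

theorem continuous_weylKernel (Ψ Θ : ZPoly) (ζ ζ' : ℂ) : Continuous (weylKernel Ψ Θ ζ ζ') :=
  continuous_iff_continuousAt.2 fun z => (hasWirt_weylKernel Ψ Θ ζ ζ' z).differentiableAt.continuousAt

theorem integrable_mul_weylKernel {σ : ℂ → ℂ} (hσ : BCInf σ) (Ψ Θ : ZPoly) (ζ ζ' : ℂ) :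
    Integrable fun z => σ z * weylKernel Ψ Θ ζ ζ' z := by
  obtain ⟨B, hB⟩ := hσ.bounded
  obtain ⟨C, hC0, hC⟩ := exists_norm_weylKernel_le Ψ Θ ζ
  refine ((expBound_of_bounded hB).mul (c := 0) (d := -(Real.pi / 16))
    ⟨C * Real.exp (15 / 32 * Real.pi * ‖ζ'‖ ^ 2), by positivity, fun z => ?_⟩).integrable
    (by linarith [Real.pi_pos])
    (hσ.continuous.mul (continuous_weylKernel Ψ Θ ζ ζ')).aestronglyMeasurable
  refine (hC ζ' z).trans (le_of_eq (by ring))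

theorem integral_symbol_by_parts {σ : ℂ → ℂ} (hσ : BCInf σ) (Ψ Θ : ZPoly) (ζ ζ' : ℂ) :
    (∫ z, (dz σ z * weylKernel Ψ Θ ζ ζ' z + (σ z * weylKernel (multP Ψ) Θ ζ ζ' z -
      σ z * weylKernel Ψ (pderiv 0 Θ) ζ ζ' z)) = 0) ∧
    (∫ z, (dzbar σ z * weylKernel Ψ Θ ζ ζ' z + (σ z * weylKernel Ψ (multP Θ) ζ ζ' z -
      σ z * weylKernel (pderiv 0 Ψ) Θ ζ ζ' z)) = 0) :=
  integral_wirt_eq_zero (fun z => ((hσ.hasWirt z).mul (hasWirt_weylKernel Ψ Θ ζ ζ' z)).congr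
    (by ring) (by ring)) (integrable_mul_weylKernel hσ _ _ _ _)
    ((integrable_mul_weylKernel hσ.dz _ _ _ _).add ((integrable_mul_weylKernel hσ _ _ _ _).sub
      (integrable_mul_weylKernel hσ _ _ _ _)))
    ((integrable_mul_weylKernel hσ.dzbar _ _ _ _).add ((integrable_mul_weylKernel hσ _ _ _ _).sub
      (integrable_mul_weylKernel hσ _ _ _ _)))

theorem integral_btIntegrand_eq_zero {σ τ F : ℂ → ℂ} (hσ : BCInf σ) (hτ : BCInf τ)
    (hF : MemLp F 2 gauss) (ζ : ℂ) {p₁ p₂ p₃ q₁ q₂ q₃ : ZPoly}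
    (h : ∀ ζ', ∫ z, (τ z * weylKernel p₁ q₁ ζ ζ' z + (σ z * weylKernel p₂ q₂ ζ ζ' z -
      σ z * weylKernel p₃ q₃ ζ ζ' z)) = 0) :
    berezinToeplitz τ (polyFun p₁) (polyFun q₁) F ζ =
      berezinToeplitz σ (polyFun p₃) (polyFun q₃) F ζ -
      berezinToeplitz σ (polyFun p₂) (polyFun q₂) F ζ := by
  have hi := integrable_btIntegrand hσ hF
  have hi' := integrable_btIntegrand hτ hF
  have h0 : ∫ x, (btIntegrand τ p₁ q₁ F ζ x + (btIntegrand σ p₂ q₂ F ζ x -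
      btIntegrand σ p₃ q₃ F ζ x)) ∂(volume.prod gauss) = 0 := by
    have ht : Integrable (fun x => btIntegrand τ p₁ q₁ F ζ x + (btIntegrand σ p₂ q₂ F ζ x -
        btIntegrand σ p₃ q₃ F ζ x)) (volume.prod gauss) :=
      (hi' _ _ _).add ((hi _ _ _).sub (hi _ _ _))
    -- Integrating over `z` first makes the hypothesis apply for each fixed `ζ'`, with `F ζ'` as a
    -- constant factor.
    rw [integral_prod_symm _ ht]
    refine integral_eq_zero_of_ae (Filter.Eventually.of_forall fun ζ' => ?_)
    have e : ∀ z, btIntegrand τ p₁ q₁ F ζ (z, ζ') + (btIntegrand σ p₂ q₂ F ζ (z, ζ') -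
        btIntegrand σ p₃ q₃ F ζ (z, ζ')) = F ζ' * (τ z * weylKernel p₁ q₁ ζ ζ' z +
        (σ z * weylKernel p₂ q₂ ζ ζ' z - σ z * weylKernel p₃ q₃ ζ ζ' z)) := by
      intro z
      simp only [btIntegrand]
      ring
    simp only [e, integral_const_mul, h, mul_zero, Pi.zero_apply]
  have hs : Integrable (fun x => btIntegrand σ p₂ q₂ F ζ x - btIntegrand σ p₃ q₃ F ζ x)
    (volume.prod gauss) := (hi _ _ _).sub (hi _ _ _)
  rw [integral_add (hi' _ _ _) hs, integral_sub (hi _ _ _) (hi _ _ _),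
    ← berezinToeplitz_eq hσ hF, ← berezinToeplitz_eq hσ hF, ← berezinToeplitz_eq hτ hF] at h0
  linear_combination h0

theorem berezinToeplitz_dz {σ F : ℂ → ℂ} (hσ : BCInf σ) (hF : MemLp F 2 gauss)
    (Ψ Θ : ZPoly) (ζ : ℂ) : berezinToeplitz (dz σ) (polyFun Ψ) (polyFun Θ) F ζ =
      berezinToeplitz σ (polyFun Ψ) (polyFun (pderiv 0 Θ)) F ζ -
      berezinToeplitz σ (polyFun (multP Ψ)) (polyFun Θ) F ζ :=
  integral_btIntegrand_eq_zero hσ hσ.dz hF ζ fun ζ' => (integral_symbol_by_parts hσ Ψ Θ ζ ζ').1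

theorem berezinToeplitz_dzbar {σ F : ℂ → ℂ} (hσ : BCInf σ) (hF : MemLp F 2 gauss)
    (Ψ Θ : ZPoly) (ζ : ℂ) : berezinToeplitz (dzbar σ) (polyFun Ψ) (polyFun Θ) F ζ =
      berezinToeplitz σ (polyFun (pderiv 0 Ψ)) (polyFun Θ) F ζ -
      berezinToeplitz σ (polyFun Ψ) (polyFun (multP Θ)) F ζ :=
  integral_btIntegrand_eq_zero hσ hσ.dzbar hF ζ fun ζ' => (integral_symbol_by_parts hσ Ψ Θ ζ ζ').2

/-! ### Berezin-Toeplitz operators as functionals of the product of the windows -/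

theorem holomorphic_induction {P : ZPoly → Prop} (h0 : P 0) (hm : ∀ (c : ℂ) (n : ℕ), P (c • X 0 ^ n))
    (ha : ∀ p q, P p → P q → P (p + q)) {φ : ZPoly} (hφ : pderiv 1 φ = 0) : P φ := by
  rw [φ.as_sum]
  refine Finset.sum_induction _ P (fun p q => ha p q) h0 fun m hms => ?_
  have h1 : m 1 = 0 := by
    by_contra h
    obtain ⟨m', hm'⟩ : ∃ m' : Fin 2 →₀ ℕ, m = m' + Finsupp.single 1 1 :=
      ⟨m - Finsupp.single 1 1, (tsub_add_cancel_of_le (by simpa using Nat.one_le_iff_ne_zero.2 h)).symm⟩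
    have h2 := congrArg (coeff m') hφ
    rw [coeff_pderiv, coeff_zero, ← hm'] at h2
    rcases mul_eq_zero.1 h2 with h3 | h3
    · exact (mem_support_iff.1 hms) h3
    · exact Nat.cast_add_one_ne_zero _ h3
  have h2 : m = Finsupp.single 0 (m 0) := by
    ext i
    fin_cases i
    · simp
    · simpa using h1
  have h3 : monomial m (coeff m φ) = coeff m φ • X 0 ^ (m 0) := by
    rw [smul_eq_C_mul, X_pow_eq_monomial, C_mul_monomial, mul_one, ← h2]
  rw [h3]
  exact hm _ _

theorem monomial_one_eq (m : Fin 2 →₀ ℕ) :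
    (monomial m (1 : ℂ) : ZPoly) = X 0 ^ m 0 * X 1 ^ m 1 := by
  rw [monomial_eq, Finsupp.prod_fintype _ _ (by simp), Fin.prod_univ_two, C_1, one_mul]

theorem raiseP_iterate_smul (k : ℕ) (c : ℂ) (p : ZPoly) :
    raiseP^[k] (c • p) = c • raiseP^[k] p := by
  rw [← Module.End.pow_apply, map_smul, Module.End.pow_apply]

theorem raiseP_iterate_add (k : ℕ) (p q : ZPoly) :
    raiseP^[k] (p + q) = raiseP^[k] p + raiseP^[k] q := iterate_map_add _ _ _ _

theorem raiseP_iterate_zero (k : ℕ) : raiseP^[k] 0 = 0 := iterate_map_zero _ _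

/-- The linear functional with value `(𝓛_σ^{Rᵏzᵃ, Rʲzᵇ} F)(ζ)` on `X₀ᵃ X₁ᵇ`. -/
def btForm (k j : ℕ) (σ F : ℂ → ℂ) (ζ : ℂ) : ZPoly →ₗ[ℂ] ℂ :=
  (basisMonomials (Fin 2) ℂ).constr ℂ fun m =>
    berezinToeplitz σ (polyFun (raiseP^[k] (X 0 ^ m 0))) (polyFun (raiseP^[j] (X 0 ^ m 1))) F ζ

theorem btForm_X_pow (k j : ℕ) (σ F : ℂ → ℂ) (ζ : ℂ) (a b : ℕ) :
    btForm k j σ F ζ (X 0 ^ a * X 1 ^ b) = berezinToeplitz σ (polyFun (raiseP^[k] (X 0 ^ a)))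
      (polyFun (raiseP^[j] (X 0 ^ b))) F ζ := by
  have := (basisMonomials (Fin 2) ℂ).constr_basis ℂ (fun m =>
    berezinToeplitz σ (polyFun (raiseP^[k] (X 0 ^ m 0))) (polyFun (raiseP^[j] (X 0 ^ m 1))) F ζ)
    (Finsupp.single 0 a + Finsupp.single 1 b)
  simp only [coe_basisMonomials, monomial_one_eq] at this
  simpa [btForm] using this

theorem linearMap_ext_X_pow {f g : ZPoly →ₗ[ℂ] ℂ}
    (h : ∀ a b : ℕ, f (X 0 ^ a * X 1 ^ b) = g (X 0 ^ a * X 1 ^ b)) : f = g :=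
  (basisMonomials (Fin 2) ℂ).ext fun m => by
    simp only [coe_basisMonomials, monomial_one_eq]; exact h _ _

theorem pderiv_one_X_zero_pow (a : ℕ) : pderiv 1 (X 0 ^ a : ZPoly) = 0 := by
  simp

/-- The operator is conjugate-linear in `Ψ` and linear in `Θ`, while `φ * conjPoly θ` is the other
way round. Conjugating coefficients reconciles the two, and the claim reduces to powers of `z`. -/
theorem btForm_map_conj {σ F : ℂ → ℂ} (hσ : BCInf σ) (hF : MemLp F 2 gauss) (k j : ℕ) (ζ : ℂ)
    {φ θ : ZPoly} (hφ : pderiv 1 φ = 0) (hθ : pderiv 1 θ = 0) :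
    btForm k j σ F ζ (MvPolynomial.map (starRingEnd ℂ) (φ * conjPoly θ)) =
      berezinToeplitz σ (polyFun (raiseP^[k] φ)) (polyFun (raiseP^[j] θ)) F ζ := by
  have hz1 : ∀ q, berezinToeplitz σ (polyFun 0) (polyFun q) F ζ = 0 := fun q => by
    simpa using berezinToeplitz_smul_left hσ hF ζ 0 0 q
  have hz2 : ∀ q, berezinToeplitz σ (polyFun q) (polyFun 0) F ζ = 0 := fun q => by
    simpa using berezinToeplitz_smul_right hσ hF ζ 0 q 0
  refine holomorphic_induction (P := fun φ => btForm k j σ F ζ (MvPolynomial.map (starRingEnd ℂ)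
    (φ * conjPoly θ)) = berezinToeplitz σ (polyFun (raiseP^[k] φ)) (polyFun (raiseP^[j] θ)) F ζ)
    ?_ (fun c a => ?_) (fun p q hp hq => ?_) hφ
  · rw [raiseP_iterate_zero, hz1, zero_mul, map_zero, map_zero]
  · rw [raiseP_iterate_smul, berezinToeplitz_smul_left hσ hF]
    refine holomorphic_induction (P := fun θ => btForm k j σ F ζ (MvPolynomial.map (starRingEnd ℂ)
      (c • X 0 ^ a * conjPoly θ)) = starRingEnd ℂ c *
      berezinToeplitz σ (polyFun (raiseP^[k] (X 0 ^ a))) (polyFun (raiseP^[j] θ)) F ζ)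
      ?_ (fun d b => ?_) (fun p q hp hq => ?_) hθ
    · rw [raiseP_iterate_zero, hz2, conjPoly_zero, mul_zero, map_zero, map_zero, mul_zero]
    · have e : MvPolynomial.map (starRingEnd ℂ) (c • X 0 ^ a * conjPoly (d • X 0 ^ b)) =
          (starRingEnd ℂ c * d) • (X 0 ^ a * X 1 ^ b : ZPoly) := by
        simp [smul_eq_C_mul, conjPoly]
        ring
      rw [e, map_smul, btForm_X_pow, raiseP_iterate_smul, berezinToeplitz_smul_right hσ hF,
        smul_eq_mul, mul_assoc]
    · rw [conjPoly_add, mul_add, map_add, map_add, hp, hq, raiseP_iterate_add,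
        berezinToeplitz_add_right hσ hF, mul_add]
  · rw [add_mul, map_add, map_add, hp, hq, raiseP_iterate_add, berezinToeplitz_add_left hσ hF]

/-- Both window operations from the integration by parts commute with raising: `multP` becomes
multiplication of `φ` by `πz`, and `∂_z` hits `θ`, which is encoded by `X 1`. -/
theorem btForm_dz {σ F : ℂ → ℂ} (hσ : BCInf σ) (hF : MemLp F 2 gauss) (k j : ℕ) (ζ : ℂ)
    (p : ZPoly) : btForm k j (dz σ) F ζ p = -Real.pi * btForm k j σ F ζ (shiftX 0 1 p) := by
  have : btForm k j (dz σ) F ζ = (-Real.pi : ℂ) • (btForm k j σ F ζ ∘ₗ shiftX 0 1) := by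
    refine linearMap_ext_X_pow fun a b => ?_
    have h2 : pderiv 0 (X 0 ^ b : ZPoly) = (b : ℂ) • X 0 ^ (b - 1) := by
      simp [smul_eq_C_mul]
    have h3 : shiftX 0 1 (X 0 ^ a * X 1 ^ b) =
        X 0 ^ (a + 1) * X 1 ^ b - ((Real.pi : ℂ)⁻¹ * b) • (X 0 ^ a * X 1 ^ (b - 1)) := by
      simp [shiftX_apply, smul_eq_C_mul, -map_inv₀]
      ring
    rw [btForm_X_pow, berezinToeplitz_dz hσ hF, pderiv_zero_raiseP_iterate,
      multP_raiseP_iterate _ (pderiv_one_X_zero_pow a), berezinToeplitz_smul_left hσ hF,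
      ← pow_succ', LinearMap.smul_apply, LinearMap.comp_apply, h2, h3, map_sub, map_smul,
      btForm_X_pow, btForm_X_pow, raiseP_iterate_smul, berezinToeplitz_smul_right hσ hF,
      Complex.conj_ofReal]
    simp only [smul_eq_mul]
    have := pi_ne_zero'
    field_simp
    ring
  rw [this]; rfl

theorem btForm_dzbar {σ F : ℂ → ℂ} (hσ : BCInf σ) (hF : MemLp F 2 gauss) (k j : ℕ) (ζ : ℂ)
    (p : ZPoly) : btForm k j (dzbar σ) F ζ p = -Real.pi * btForm k j σ F ζ (shiftX 1 0 p) := by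
  have : btForm k j (dzbar σ) F ζ = (-Real.pi : ℂ) • (btForm k j σ F ζ ∘ₗ shiftX 1 0) := by
    refine linearMap_ext_X_pow fun a b => ?_
    have h2 : pderiv 0 (X 0 ^ a : ZPoly) = (a : ℂ) • X 0 ^ (a - 1) := by
      simp [smul_eq_C_mul]
    have h3 : shiftX 1 0 (X 0 ^ a * X 1 ^ b) =
        X 0 ^ a * X 1 ^ (b + 1) - ((Real.pi : ℂ)⁻¹ * a) • (X 0 ^ (a - 1) * X 1 ^ b) := by
      simp [shiftX_apply, smul_eq_C_mul, -map_inv₀]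
      ring
    rw [btForm_X_pow, berezinToeplitz_dzbar hσ hF, pderiv_zero_raiseP_iterate,
      multP_raiseP_iterate _ (pderiv_one_X_zero_pow b), berezinToeplitz_smul_right hσ hF,
      ← pow_succ', LinearMap.smul_apply, LinearMap.comp_apply, h2, h3, map_sub, map_smul,
      btForm_X_pow, btForm_X_pow, raiseP_iterate_smul, berezinToeplitz_smul_left hσ hF,
      Complex.conj_natCast]
    simp only [smul_eq_mul]
    have := pi_ne_zero'
    field_simp
    ring
  rw [this]; rfl

/-- The functional `btForm` composed with `e^{-Δ/4π}`. -/
def heatForm (k j : ℕ) (σ F : ℂ → ℂ) (ζ : ℂ) : ZPoly →ₗ[ℂ] ℂ := btForm k j σ F ζ ∘ₗ heatInv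

/-- The reason for composing with `heatInv`: differentiation of the symbol becomes a plain
multiplication, so that composition of differential operators matches the product of polynomials. -/
theorem heatForm_dz {σ F : ℂ → ℂ} (hσ : BCInf σ) (hF : MemLp F 2 gauss) (k j : ℕ) (ζ : ℂ)
    (p : ZPoly) : heatForm k j (dz σ) F ζ p = -Real.pi * heatForm k j σ F ζ (X 0 * p) := by
  rw [heatForm, heatForm, LinearMap.comp_apply, LinearMap.comp_apply, heatInv_X_zero_mul,
    btForm_dz hσ hF]

theorem heatForm_dzbar {σ F : ℂ → ℂ} (hσ : BCInf σ) (hF : MemLp F 2 gauss) (k j : ℕ) (ζ : ℂ)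
    (p : ZPoly) : heatForm k j (dzbar σ) F ζ p = -Real.pi * heatForm k j σ F ζ (X 1 * p) := by
  rw [heatForm, heatForm, LinearMap.comp_apply, LinearMap.comp_apply, heatInv_X_one_mul,
    btForm_dzbar hσ hF]

theorem heatForm_dz_iterate {σ F : ℂ → ℂ} (hσ : BCInf σ) (hF : MemLp F 2 gauss) (k j : ℕ) (ζ : ℂ)
    (a : ℕ) (p : ZPoly) :
    heatForm k j (dz^[a] σ) F ζ p = (-Real.pi : ℂ) ^ a * heatForm k j σ F ζ (X 0 ^ a * p) := by
  induction a generalizing p with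
  | zero => simp
  | succ a ih =>
    rw [Function.iterate_succ_apply', heatForm_dz (hσ.dz_iterate a) hF, ih]
    ring_nf

theorem heatForm_dzbar_iterate {σ F : ℂ → ℂ} (hσ : BCInf σ) (hF : MemLp F 2 gauss) (k j : ℕ)
    (ζ : ℂ) (b : ℕ) (p : ZPoly) :
    heatForm k j (dzbar^[b] σ) F ζ p = (-Real.pi : ℂ) ^ b * heatForm k j σ F ζ (X 1 ^ b * p) := by
  induction b generalizing p with
  | zero => simp
  | succ b ih =>
    rw [Function.iterate_succ_apply', heatForm_dzbar (hσ.dzbar_iterate b) hF, ih]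
    ring_nf

theorem heatForm_map_conj {σ F : ℂ → ℂ} (hσ : BCInf σ) (hF : MemLp F 2 gauss) (k j : ℕ) (ζ : ℂ)
    {φ θ : ZPoly} (hφ : pderiv 1 φ = 0) (hθ : pderiv 1 θ = 0) :
    heatForm k j σ F ζ (MvPolynomial.map (starRingEnd ℂ) (heat (φ * conjPoly θ))) =
      berezinToeplitz σ (polyFun (raiseP^[k] φ)) (polyFun (raiseP^[j] θ)) F ζ := by
  rw [heatForm, LinearMap.comp_apply, map_conj_heat, heatInv_heat,
    btForm_map_conj hσ hF k j ζ hφ hθ]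

/-! ### Symbols of differential operators -/

/-- The semilinear ring automorphism `∑ cₘ Xᵐ ↦ ∑ (conj cₘ) π^{|m|/2} Xᵐ`. -/
def symbolEquiv : ZPoly ≃+* ZPoly :=
  RingEquiv.ofRingHom
    (eval₂Hom (C.comp (starRingEnd ℂ)) fun i => C rtpi * X i)
    (eval₂Hom (C.comp (starRingEnd ℂ)) fun i => C rtpi⁻¹ * X i)
    (ringHom_ext (fun c => by simp) fun i => by
      have h := C_rtpi_inv_mul
      simp [-map_inv₀, map_inv₀ (starRingEnd ℂ), conj_rtpi]
      linear_combination X i * h)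
    (ringHom_ext (fun c => by simp) fun i => by
      have h := C_rtpi_inv_mul
      simp [-map_inv₀, conj_rtpi]
      linear_combination X i * h)

theorem symbolEquiv_eq_sum (D : ZPoly) : symbolEquiv D = ∑ m ∈ D.support,
    (starRingEnd ℂ (D.coeff m) * rtpi ^ (m 0 + m 1)) • (X 0 ^ m 0 * X 1 ^ m 1 : ZPoly) := by
  change eval₂ (C.comp (starRingEnd ℂ)) (fun i => C rtpi * X i) D = _
  rw [eval₂_eq']
  refine Finset.sum_congr rfl fun m _ => ?_
  simp only [RingHom.comp_apply, Fin.prod_univ_two, mul_pow, pow_add, smul_eq_C_mul, C_mul, C_pow]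
  ring

/-- Rescaling variables never raises the degree; the same bound for the inverse gives equality. -/
theorem totalDegree_symbolEquiv (D : ZPoly) : (symbolEquiv D).totalDegree = D.totalDegree := by
  have key : ∀ (c : ℂ) (p : ZPoly),
      (eval₂Hom (C.comp (starRingEnd ℂ)) (fun i => C c * X i) p).totalDegree ≤ p.totalDegree := by
    intro c p
    change (eval₂ (C.comp (starRingEnd ℂ)) (fun i => C c * X i) p).totalDegree ≤ _
    rw [eval₂_eq']
    refine totalDegree_finsetSum_le fun m hm => ?_
    have h1 := le_totalDegree hm
    rw [Finsupp.sum_fintype _ _ (fun _ => rfl), Fin.sum_univ_two] at h1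
    refine le_trans ?_ h1
    have e : (C.comp (starRingEnd ℂ)) (coeff m p) * ∏ i : Fin 2, (C c * X i) ^ m i =
        monomial m (starRingEnd ℂ (coeff m p) * c ^ (m 0 + m 1)) := by
      rw [← mul_one (_ * c ^ _), ← C_mul_monomial, monomial_one_eq]
      simp only [RingHom.comp_apply, Fin.prod_univ_two, mul_pow, pow_add, C_mul, C_pow]
      ring
    rw [e]
    refine (totalDegree_monomial_le _ _).trans (le_of_eq ?_)
    rw [Finsupp.sum_fintype _ _ (fun _ => rfl), Fin.sum_univ_two]
    rfl
  refine le_antisymm (key rtpi D) ?_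
  have := key rtpi⁻¹ (symbolEquiv D)
  have e : eval₂Hom (C.comp (starRingEnd ℂ)) (fun i => C rtpi⁻¹ * X i) (symbolEquiv D) = D :=
    symbolEquiv.symm_apply_apply D
  rwa [e] at this

theorem BCInf.sum {ι : Type*} (s : Finset ι) {σ : ι → ℂ → ℂ} (h : ∀ i, BCInf (σ i)) :
    BCInf fun z => ∑ i ∈ s, σ i z := by
  classical
  induction s using Finset.induction_on with
  | empty =>
    simp only [Finset.sum_empty]
    exact ⟨contDiff_const, fun m => ⟨‖(0 : ℂ)‖, fun z => by
      have : iteratedFDeriv ℝ m (fun _ : ℂ => (0 : ℂ)) z = 0 := by simp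
      rw [this]; simp⟩⟩
  | insert i s hi ih =>
    simp only [Finset.sum_insert hi]
    exact (h i).add ih

theorem berezinToeplitz_sum_symbol {ι : Type*} (s : Finset ι) {σ : ι → ℂ → ℂ} {F : ℂ → ℂ}
    (h : ∀ i, BCInf (σ i)) (hF : MemLp F 2 gauss) (ζ : ℂ) (Ψ Θ : ZPoly) :
    berezinToeplitz (fun z => ∑ i ∈ s, σ i z) (polyFun Ψ) (polyFun Θ) F ζ =
      ∑ i ∈ s, berezinToeplitz (σ i) (polyFun Ψ) (polyFun Θ) F ζ := by
  classical
  induction s using Finset.induction_on with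
  | empty => simp [berezinToeplitz]
  | insert i s hi ih =>
    simp only [Finset.sum_insert hi]
    rw [berezinToeplitz_add_symbol (h i) (BCInf.sum s h) hF, ih]

theorem berezinToeplitz_diffOp {σ F : ℂ → ℂ} (hσ : BCInf σ) (hF : MemLp F 2 gauss) (k j : ℕ)
    (ζ : ℂ) {φ θ : ZPoly} (hφ : pderiv 1 φ = 0) (hθ : pderiv 1 θ = 0) (D : ZPoly) :
    berezinToeplitz (diffOp D σ) (polyFun (raiseP^[k] φ)) (polyFun (raiseP^[j] θ)) F ζ =
      heatForm k j σ F ζ (MvPolynomial.map (starRingEnd ℂ)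
        (symbolEquiv D * heat (φ * conjPoly θ))) := by
  have h := berezinToeplitz_sum_symbol D.support (σ := fun m z => D.coeff m *
    (-(Real.sqrt Real.pi : ℂ)⁻¹) ^ (m 0 + m 1) * (dzbar^[m 1] (dz^[m 0] σ)) z)
    (fun m => ((hσ.dz_iterate (m 0)).dzbar_iterate (m 1)).const_mul _) hF ζ
    (raiseP^[k] φ) (raiseP^[j] θ)
  unfold diffOp
  rw [h, symbolEquiv_eq_sum, Finset.sum_mul, map_sum, map_sum]
  refine Finset.sum_congr rfl fun m _ => ?_
  have hb := (hσ.dz_iterate (m 0)).dzbar_iterate (m 1)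
  have e1 : MvPolynomial.map (starRingEnd ℂ)
      ((starRingEnd ℂ (coeff m D) * rtpi ^ (m 0 + m 1)) • (X 0 ^ m 0 * X 1 ^ m 1 : ZPoly) *
        heat (φ * conjPoly θ)) = (coeff m D * rtpi ^ (m 0 + m 1)) • (X 0 ^ m 0 * (X 1 ^ m 1 *
        MvPolynomial.map (starRingEnd ℂ) (heat (φ * conjPoly θ))) : ZPoly) := by
    simp only [smul_eq_C_mul, map_mul, map_pow, map_C, map_X, Complex.conj_conj, conj_rtpi]
    ring
  -- Each derivative contributes `-1/√π` from the Wick replacement and `-π` from the integration by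
  -- parts; the product is the `√π` built into `symbolEquiv`.
  have e2 : rtpi = -rtpi⁻¹ * (-Real.pi : ℂ) := by
    rw [← rtpi_mul_self]
    have := rtpi_ne_zero
    field_simp
  have e3 : rtpi ^ (m 0 + m 1) = (-rtpi⁻¹) ^ (m 0 + m 1) * (-Real.pi : ℂ) ^ (m 0 + m 1) := by
    rw [← mul_pow, ← e2]
  rw [berezinToeplitz_const_mul_symbol hb hF, ← heatForm_map_conj hb hF k j ζ hφ hθ,
    heatForm_dzbar_iterate (hσ.dz_iterate (m 0)) hF, heatForm_dz_iterate hσ hF, e1, map_smul,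
    smul_eq_mul, e3, ← rtpi]
  ring

/-! ### Plane waves -/

/-- The character `z ↦ e^{π(w z̄ - w̄ z)}` of `ℂ`. -/
def planeWave (w z : ℂ) : ℂ :=
  Complex.exp (Real.pi * (w * starRingEnd ℂ z - starRingEnd ℂ w * z))

theorem hasWirt_planeWave (w z : ℂ) : HasWirt (planeWave w)
    (-Real.pi * starRingEnd ℂ w * planeWave w z) (Real.pi * w * planeWave w z) z :=
  ((((hasWirt_conj z).const_mul w).sub ((hasWirt_id z).const_mul (starRingEnd ℂ w))).const_mul
    (Real.pi : ℂ)).cexp.congr (by rw [planeWave]; ring) (by rw [planeWave]; ring)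

theorem dz_planeWave (w : ℂ) :
    dz (planeWave w) = fun z => -Real.pi * starRingEnd ℂ w * planeWave w z :=
  funext fun z => (hasWirt_planeWave w z).dz

theorem dzbar_planeWave (w : ℂ) : dzbar (planeWave w) = fun z => Real.pi * w * planeWave w z :=
  funext fun z => (hasWirt_planeWave w z).dzbar

theorem bcInf_planeWave (w : ℂ) : BCInf (planeWave w) := by
  have hd : ContDiff ℝ (⊤ : ℕ∞) (planeWave w) := by
    have h : ContDiff ℝ (⊤ : ℕ∞) fun z : ℂ => starRingEnd ℂ z :=
      (Complex.conjCLE : ℂ →L[ℝ] ℂ).contDiff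
    unfold planeWave
    exact (contDiff_const.mul ((contDiff_const.mul h).sub (contDiff_const.mul contDiff_id))).cexp
  refine ⟨hd, fun m => ?_⟩
  induction m with
  | zero =>
    refine ⟨1, fun z => ?_⟩
    rw [norm_iteratedFDeriv_zero, planeWave, Complex.norm_exp]
    refine le_of_eq (Real.exp_eq_one_iff _ |>.2 ?_)
    simp
  | succ m ih =>
    obtain ⟨C, hC⟩ := ih
    set L := wirt (-Real.pi * starRingEnd ℂ w) (Real.pi * w)
    set T : ℂ →L[ℝ] (ℂ →L[ℝ] ℂ) := (ContinuousLinearMap.lsmul ℝ ℂ).flip L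
    -- The derivative is a fixed linear image of the function itself, so bounds pass from order `m`
    -- to `m + 1`.
    have hT : fderiv ℝ (planeWave w) = T ∘ planeWave w := by
      funext z
      rw [HasFDerivAt.fderiv (hasWirt_planeWave w z)]
      ext v
      simp [T, L]
      ring
    refine ⟨‖T‖ * C, fun z => ?_⟩
    rw [← norm_iteratedFDeriv_fderiv, hT]
    exact (T.norm_iteratedFDeriv_comp_left (N := (⊤ : ℕ∞)) hd.contDiffAt
      (by exact_mod_cast le_top)).trans (mul_le_mul_of_nonneg_left (hC z) (norm_nonneg T))

theorem heatForm_const_mul {σ F : ℂ → ℂ} (hσ : BCInf σ) (hF : MemLp F 2 gauss) (k j : ℕ) (ζ c : ℂ)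
    (p : ZPoly) :
    heatForm k j (fun z => c * σ z) F ζ p = c * heatForm k j σ F ζ p := by
  have : btForm k j (fun z => c * σ z) F ζ = c • btForm k j σ F ζ :=
    linearMap_ext_X_pow fun a b => by
      rw [LinearMap.smul_apply, btForm_X_pow, btForm_X_pow, smul_eq_mul,
        berezinToeplitz_const_mul_symbol hσ hF]
  rw [heatForm, this]; rfl

/-- The eigenvalues `-π w̄` of `∂_z` and `π w` of `∂_{z̄}`, divided by `-π`, give the evaluation
point. -/
theorem heatForm_planeWave {F : ℂ → ℂ} (hF : MemLp F 2 gauss) (k j : ℕ) (ζ w : ℂ) (p : ZPoly) :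
    heatForm k j (planeWave w) F ζ p =
      eval ![starRingEnd ℂ w, -w] p * heatForm k j (planeWave w) F ζ 1 := by
  have hb := bcInf_planeWave w
  have hπ := pi_ne_zero'
  have h0 : ∀ q, heatForm k j (planeWave w) F ζ (X 0 * q) =
      starRingEnd ℂ w * heatForm k j (planeWave w) F ζ q := fun q => by
    have := heatForm_dz hb hF k j ζ q
    rw [dz_planeWave, heatForm_const_mul hb hF] at this
    refine mul_left_cancel₀ hπ ?_
    linear_combination this
  have h1 : ∀ q, heatForm k j (planeWave w) F ζ (X 1 * q) =
      -w * heatForm k j (planeWave w) F ζ q := fun q => by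
    have := heatForm_dzbar hb hF k j ζ q
    rw [dzbar_planeWave, heatForm_const_mul hb hF] at this
    refine mul_left_cancel₀ hπ ?_
    linear_combination this
  induction p using MvPolynomial.induction_on with
  | C a => rw [← mul_one (C a), ← smul_eq_C_mul, map_smul, smul_eq_mul, smul_eval,
      (eval _).map_one, mul_one]
  | add p q hp hq => rw [map_add, map_add, hp, hq, add_mul]
  | mul_X p i hp =>
    rw [mul_comm p, (eval _).map_mul, mul_assoc, ← hp]
    fin_cases i
    · simpa using h0 p
    · simpa using h1 p

theorem raiseP_iterate_one (k : ℕ) : raiseP^[k] 1 = rtpi ^ k • (X 1 ^ k : ZPoly) := by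
  induction k with
  | zero => simp
  | succ k ih =>
    rw [Function.iterate_succ_apply', ih, map_smul, raiseP_apply]
    have : pderiv 0 (X 1 ^ k : ZPoly) = 0 := by simp
    rw [this, mul_zero, sub_zero, ← pow_succ', ← smul_eq_C_mul, smul_smul, ← pow_succ]

theorem heatForm_one {σ F : ℂ → ℂ} (hσ : BCInf σ) (hF : MemLp F 2 gauss) (k j : ℕ) (ζ : ℂ) :
    heatForm k j σ F ζ 1 = rtpi ^ (k + j) *
      berezinToeplitz σ (polyFun (X 1 ^ k)) (polyFun (X 1 ^ j)) F ζ := by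
  have h := heatForm_map_conj hσ hF k j ζ (φ := 1) (θ := 1) pderiv_one pderiv_one
  have e : conjPoly 1 = 1 := by simpa using conjPoly_C 1
  rw [e, mul_one, heat_one, map_one] at h
  rw [h, raiseP_iterate_one, raiseP_iterate_one, berezinToeplitz_smul_left hσ hF,
    berezinToeplitz_smul_right hσ hF, map_pow, conj_rtpi, pow_add, mul_assoc]

/-- For these parameters `∂_{z̄}` of the weight is `-π(X 0 - z)` times the weight, so integration by
parts removes one factor `X 0 - C z` and one factor `X 1` (`hr`). -/
theorem gaussInt_X_one_pow_mul (z : ℂ) (k l : ℕ) :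
    gaussInt (X 1 ^ k * (X 0 - C z) ^ l) 0 (Real.pi * z) =
      if k = l then (k.factorial : ℂ) / (Real.pi : ℂ) ^ k else 0 := by
  have hπ := pi_ne_zero'
  have hr : ∀ k l : ℕ, (Real.pi : ℂ) * gaussInt (X 1 ^ k * (X 0 - C z) ^ (l + 1)) 0 (Real.pi * z) =
      k * gaussInt (X 1 ^ (k - 1) * (X 0 - C z) ^ l) 0 (Real.pi * z) := by
    intro k l
    have h := (gaussInt_pderiv (X 1 ^ k * (X 0 - C z) ^ l) 0 (Real.pi * z)).2
    have e : pderiv 1 (X 1 ^ k * (X 0 - C z) ^ l : ZPoly) + C (Real.pi * z) * (X 1 ^ k * (X 0 - C z) ^ l) -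
        C (Real.pi : ℂ) * (X 0 * (X 1 ^ k * (X 0 - C z) ^ l)) =
        C (k : ℂ) * (X 1 ^ (k - 1) * (X 0 - C z) ^ l) -
          C (Real.pi : ℂ) * (X 1 ^ k * (X 0 - C z) ^ (l + 1)) := by
      simp
      ring
    replace h := (congrArg (gaussInt · 0 (Real.pi * z)) e).symm.trans h
    rw [gaussInt_sub, gaussInt_C_mul, gaussInt_C_mul] at h
    linear_combination -h
  -- With `α = 0`, `X 1 ^ (k + 1)` times the weight is a constant multiple of a `∂_z` derivative.
  have hl : ∀ k : ℕ, gaussInt (X 1 ^ (k + 1) * (X 0 - C z) ^ 0) 0 (Real.pi * z) = 0 := by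
    intro k
    have h := (gaussInt_pderiv (X 1 ^ k) 0 (Real.pi * z)).1
    have e : pderiv 0 (X 1 ^ k : ZPoly) + C 0 * X 1 ^ k - C (Real.pi : ℂ) * (X 1 * X 1 ^ k) =
        C (-Real.pi : ℂ) * (X 1 ^ (k + 1) * (X 0 - C z) ^ 0) := by
      simp
      ring
    replace h := (congrArg (gaussInt · 0 (Real.pi * z)) e).symm.trans h
    rw [gaussInt_C_mul] at h
    exact (mul_eq_zero.1 h).resolve_left (neg_ne_zero.2 hπ)
  induction k generalizing l with
  | zero =>
    cases l with
    | zero => simp [gaussInt_one]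
    | succ l =>
      have h := hr 0 l
      rw [Nat.cast_zero, zero_mul] at h
      rw [(mul_eq_zero.1 h).resolve_left hπ, if_neg (Nat.succ_ne_zero l).symm]
  | succ k ih =>
    cases l with
    | zero => rw [hl, if_neg (Nat.succ_ne_zero k)]
    | succ l =>
      have h := hr (k + 1) l
      rw [Nat.add_sub_cancel, ih] at h
      refine mul_left_cancel₀ hπ ?_
      rw [h]
      by_cases hkl : k = l
      · subst hkl
        rw [if_pos rfl, if_pos rfl, Nat.factorial_succ]
        push_cast
        field_simp
        ring
      · rw [if_neg hkl, if_neg (fun h => hkl (Nat.succ_injective h)), mul_zero, mul_zero]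

theorem ip_weyl_X_one_pow (z : ℂ) (k l : ℕ) :
    ip (polyFun (X 1 ^ k)) (weyl z (polyFun (X 1 ^ l))) =
      (if k = l then (k.factorial : ℂ) / (Real.pi : ℂ) ^ k else 0) *
        Complex.exp (-Real.pi / 2 * (z * starRingEnd ℂ z)) := by
  rw [← gaussInt_X_one_pow_mul z k l, ip, integral_gauss, gaussInt, ← integral_mul_const]
  refine integral_congr_ae (Filter.Eventually.of_forall fun ζ => ?_)
  have e : Complex.exp (Real.pi * z * starRingEnd ℂ ζ - Real.pi / 2 * (z * starRingEnd ℂ z)) *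
      Complex.exp (((-Real.pi : ℝ) : ℂ) * (ζ * starRingEnd ℂ ζ)) =
      expWeight 0 (Real.pi * z) ζ * Complex.exp (-Real.pi / 2 * (z * starRingEnd ℂ z)) := by
    rw [expWeight_eq, ← Complex.exp_add, ← Complex.exp_add]
    push_cast
    ring_nf
  simp only [conj_weyl_eq, polyFun_mul, polyFun_pow, polyFun_sub, polyFun_C, polyFun_X_one,
    polyFun_X_zero, map_pow, Complex.conj_conj]
  linear_combination (starRingEnd ℂ ζ ^ k * (ζ - z) ^ l) * e

theorem gaussInt_sub_X_one_pow (a w β : ℂ) (j : ℕ) :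
    gaussInt ((C a - X 1) ^ j) (-Real.pi * w) β = (a + w) ^ j * Complex.exp (-w * β) := by
  have hπ := pi_ne_zero'
  induction j with
  | zero =>
    rw [pow_zero, pow_zero, gaussInt_one, one_mul]
    congr 1
    field_simp
  | succ j ih =>
    have h := (gaussInt_pderiv ((C a - X 1) ^ j) (-Real.pi * w) β).1
    have e : pderiv 0 ((C a - X 1) ^ j : ZPoly) + C (-Real.pi * w) * (C a - X 1) ^ j -
        C (Real.pi : ℂ) * (X 1 * (C a - X 1) ^ j) =
        C (Real.pi : ℂ) * ((C a - X 1) ^ (j + 1) - C (a + w) * (C a - X 1) ^ j) := by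
      simp
      ring
    replace h := (congrArg (gaussInt · (-Real.pi * w) β) e).symm.trans h
    rw [gaussInt_C_mul, gaussInt_sub, gaussInt_C_mul, ih] at h
    have h2 := (mul_eq_zero.1 h).resolve_left hπ
    linear_combination h2

/-- The inner product leaves a centred Gaussian in `z`. Merged with the plane wave and the Weyl
factor it is a single weight, under which `ζ̄ - z̄` contributes `ζ̄ + w̄`. -/
theorem berezinToeplitz_planeWave (w ζ : ℂ) (k l j : ℕ) :
    berezinToeplitz (planeWave w) (polyFun (X 1 ^ l)) (polyFun (X 1 ^ j)) (polyFun (X 1 ^ k)) ζ =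
      (if k = l then (k.factorial : ℂ) / (Real.pi : ℂ) ^ k else 0) *
        ((starRingEnd ℂ ζ + starRingEnd ℂ w) ^ j *
          Complex.exp (-starRingEnd ℂ w * (Real.pi * (w + ζ)))) := by
  rw [← gaussInt_sub_X_one_pow, berezinToeplitz, gaussInt, ← integral_const_mul]
  refine integral_congr_ae (Filter.Eventually.of_forall fun z => ?_)
  have e : planeWave w z * Complex.exp (-Real.pi / 2 * (z * starRingEnd ℂ z)) *
      Complex.exp (Real.pi * starRingEnd ℂ z * ζ - Real.pi / 2 * (z * starRingEnd ℂ z)) =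
      expWeight (-Real.pi * starRingEnd ℂ w) (Real.pi * (w + ζ)) z := by
    rw [planeWave, expWeight_eq, ← Complex.exp_add, ← Complex.exp_add]
    ring_nf
  simp only [ip_weyl_X_one_pow, weyl_eq, polyFun_pow, polyFun_sub, polyFun_C, polyFun_X_one,
    map_sub]
  rw [← e]
  ring

/-! ### The localization identity -/

theorem berezinToeplitz_sum_windows {σ F : ℂ → ℂ} (hσ : BCInf σ) (hF : MemLp F 2 gauss) (ζ : ℂ)
    {ι κ : Type*} (s : Finset ι) (t : Finset κ) (Ψ : κ → ZPoly) (Θ : ι → ZPoly) :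
    berezinToeplitz σ (polyFun (∑ k ∈ t, Ψ k)) (polyFun (∑ j ∈ s, Θ j)) F ζ =
      ∑ j ∈ s, ∑ k ∈ t, berezinToeplitz σ (polyFun (Ψ k)) (polyFun (Θ j)) F ζ := by
  classical
  induction s using Finset.induction_on with
  | empty =>
    simpa using berezinToeplitz_smul_right hσ hF ζ 0 (∑ k ∈ t, Ψ k) 0
  | insert j s hj ih =>
    rw [Finset.sum_insert hj, Finset.sum_insert hj, berezinToeplitz_add_right hσ hF, ih]
    congr 1
    clear ih
    induction t using Finset.induction_on with
    | empty =>
      simpa using berezinToeplitz_smul_left hσ hF ζ 0 0 (Θ j)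
    | insert k t hk ih =>
      rw [Finset.sum_insert hk, Finset.sum_insert hk, berezinToeplitz_add_left hσ hF, ih]

/-- Up to conjugation and the sign change `A` of the second variable, the points `(w̄, -w)` are the
points `(w, w̄)`, which determine a polynomial. -/
theorem eq_zero_of_eval_eq_zero {p : ZPoly}
    (h : ∀ w : ℂ, eval ![starRingEnd ℂ w, -w] (MvPolynomial.map (starRingEnd ℂ) p) = 0) :
    p = 0 := by
  set A : ZPoly →ₐ[ℂ] ZPoly := aeval ![X 0, -X 1]
  have hAA : ∀ q, A (A q) = q := fun q => by
    have : A.comp A = AlgHom.id ℂ ZPoly := by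
      refine MvPolynomial.algHom_ext fun i => ?_
      fin_cases i <;> simp [A]
    exact DFunLike.congr_fun this q
  have hE : ∀ q w, starRingEnd ℂ (polyFun (A q) w) =
      eval ![starRingEnd ℂ w, -w] (MvPolynomial.map (starRingEnd ℂ) q) := by
    intro q w
    induction q using MvPolynomial.induction_on with
    | C a => simp [A, algHom_C, algebraMap_eq]
    | add p q hp hq => rw [map_add, polyFun_add, map_add, hp, hq, map_add, map_add]
    | mul_X p i hp =>
      rw [map_mul, polyFun_mul, map_mul, hp, map_mul, map_mul]
      congr 1
      fin_cases i
      · simp [A]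
      · simp [A, polyFun]
  have hA : A p = 0 := eq_zero_of_polyFun_eq_zero fun w => by
    have := hE p w
    rw [h] at this
    simpa using this
  rw [← hAA p, hA, map_zero]

/-- Almost everywhere equality of polynomials is identity, so `z̄` becomes a free variable and can
be translated by `-w`. -/
theorem eq_zero_of_ae_sum_pow_eq_zero {n : ℕ} {c : Fin (n + 1) → ℂ} {w : ℂ}
    (h : ∀ᵐ ζ ∂gauss, ∑ j, c j * (starRingEnd ℂ ζ + w) ^ (j : ℕ) = 0) (j : Fin (n + 1)) :
    c j = 0 := by
  have h1 : (∑ j : Fin (n + 1), C (c j) * (X 1 + C w) ^ (j : ℕ) : ZPoly) = 0 :=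
    polyFun_injective_ae (by
      filter_upwards [h] with ζ hζ
      rw [polyFun_sum, polyFun_zero, ← hζ]
      simp)
  have h2 : (∑ j : Fin (n + 1), Polynomial.monomial (j : ℕ) (c j)) = 0 :=
    Polynomial.funext fun t => by
      have h3 := congrArg (eval ![0, t - w]) h1
      simpa [Polynomial.eval_finsetSum, eval_sum] using h3
  have h3 := congrArg (fun p => Polynomial.coeff p (j : ℕ)) h2
  simpa [Polynomial.finsetSum_coeff, Polynomial.coeff_monomial, Fin.val_inj] using h3

theorem localizationIdentity_iff {n : ℕ} {Ψ Θ Ψs Θs : ZPoly} {φ φs θ θs : ℕ → ZPoly}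
    (hφ : ∀ k, pderiv 1 (φ k) = 0) (hφs : ∀ k, pderiv 1 (φs k) = 0)
    (hθ : ∀ k, pderiv 1 (θ k) = 0) (hθs : ∀ k, pderiv 1 (θs k) = 0)
    (hΨ : Ψ = ∑ k : Fin (n + 1), raiseP^[k] (φ k)) (hΘ : Θ = ∑ j : Fin (n + 1), raiseP^[j] (θ j))
    (hΨs : ∀ k ≤ n, proj k Ψs = raiseP^[k] (φs k)) (hΘs : ∀ j ≤ n, proj j Θs = raiseP^[j] (θs j))
    (D : Fin (n + 1) → Fin (n + 1) → ZPoly) :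
    LocalizationIdentity n Ψ Θ Ψs Θs D ↔ ∀ j k : Fin (n + 1),
      heat (φ k * conjPoly (θ j)) = symbolEquiv (D j k) * heat (φs k * conjPoly (θs j)) := by
  have hl : ∀ σ F ζ, BCInf σ → MemLp F 2 gauss →
      berezinToeplitz σ (polyFun Ψ) (polyFun Θ) F ζ = ∑ j : Fin (n + 1), ∑ k : Fin (n + 1),
        heatForm k j σ F ζ (MvPolynomial.map (starRingEnd ℂ) (heat (φ k * conjPoly (θ j)))) := by
    intro σ F ζ hσ hF
    rw [hΨ, hΘ, berezinToeplitz_sum_windows hσ hF]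
    refine Finset.sum_congr rfl fun j _ => Finset.sum_congr rfl fun k _ => ?_
    rw [heatForm_map_conj hσ hF k j ζ (hφ k) (hθ j)]
  have hr : ∀ σ F ζ, BCInf σ → MemLp F 2 gauss →
      (∑ j : Fin (n + 1), ∑ k : Fin (n + 1),
        berezinToeplitz (diffOp (D j k) σ) (polyFun (proj k Ψs)) (polyFun (proj j Θs)) F) ζ =
      ∑ j : Fin (n + 1), ∑ k : Fin (n + 1), heatForm k j σ F ζ (MvPolynomial.map (starRingEnd ℂ)
        (symbolEquiv (D j k) * heat (φs k * conjPoly (θs j)))) := by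
    intro σ F ζ hσ hF
    simp only [Finset.sum_apply]
    refine Finset.sum_congr rfl fun j _ => Finset.sum_congr rfl fun k _ => ?_
    rw [hΨs k (Nat.lt_succ_iff.1 k.2), hΘs j (Nat.lt_succ_iff.1 j.2),
      berezinToeplitz_diffOp hσ hF k j ζ (hφs k) (hθs j)]
  constructor
  · intro h j₀ k₀
    rw [← sub_eq_zero]
    refine eq_zero_of_eval_eq_zero fun w => ?_
    -- This test function pairs nontrivially only with the window of level `k₀`, collapsing the sum
    -- over `k`.
    have hF : MemLp (polyFun (X 1 ^ (k₀ : ℕ))) 2 gauss := memLp_polyFun _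
    have hb := bcInf_planeWave w
    set e : Fin (n + 1) → Fin (n + 1) → ℂ := fun j k => eval ![starRingEnd ℂ w, -w]
      (MvPolynomial.map (starRingEnd ℂ) (heat (φ k * conjPoly (θ j)) -
        symbolEquiv (D j k) * heat (φs k * conjPoly (θs j)))) with he
    have h1 : ∀ᵐ ζ ∂gauss, ∑ j, (e j k₀ * rtpi ^ (j : ℕ)) *
        (starRingEnd ℂ ζ + starRingEnd ℂ w) ^ (j : ℕ) = 0 := by
      filter_upwards [h (planeWave w) hb _ hF] with ζ hζ
      rw [hl _ _ _ hb hF, hr _ _ _ hb hF, ← sub_eq_zero, ← Finset.sum_sub_distrib] at hζ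
      -- The nonvanishing factor common to all `j`; after division a polynomial in `ζ̄ + w̄`
      -- remains.
      set E : ℂ := (((k₀ : ℕ).factorial : ℂ) / (Real.pi : ℂ) ^ (k₀ : ℕ)) * rtpi ^ (k₀ : ℕ) *
        Complex.exp (-starRingEnd ℂ w * (Real.pi * (w + ζ))) with hE
      have hE0 : E ≠ 0 := by
        refine mul_ne_zero (mul_ne_zero (div_ne_zero ?_ (pow_ne_zero _ pi_ne_zero'))
          (pow_ne_zero _ rtpi_ne_zero)) (Complex.exp_ne_zero _)
        exact_mod_cast Nat.factorial_ne_zero _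
      have h2 : ∀ j : Fin (n + 1), (∑ k : Fin (n + 1), heatForm k j (planeWave w)
          (polyFun (X 1 ^ (k₀ : ℕ))) ζ
            (MvPolynomial.map (starRingEnd ℂ) (heat (φ k * conjPoly (θ j))))) -
          (∑ k : Fin (n + 1), heatForm k j (planeWave w) (polyFun (X 1 ^ (k₀ : ℕ))) ζ
            (MvPolynomial.map (starRingEnd ℂ)
              (symbolEquiv (D j k) * heat (φs k * conjPoly (θs j))))) =
          E * ((e j k₀ * rtpi ^ (j : ℕ)) *
            (starRingEnd ℂ ζ + starRingEnd ℂ w) ^ (j : ℕ)) := by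
        intro j
        rw [← Finset.sum_sub_distrib, Finset.sum_eq_single k₀]
        · rw [← map_sub, ← map_sub, heatForm_planeWave hF, heatForm_one hb hF,
            berezinToeplitz_planeWave, if_pos rfl, pow_add]
          simp only [he, hE]
          ring
        · intro k _ hk
          rw [← map_sub, ← map_sub, heatForm_planeWave hF, heatForm_one hb hF,
            berezinToeplitz_planeWave, if_neg (fun h => hk (Fin.ext h.symm)), zero_mul, mul_zero,
            mul_zero]
        · simp
      simp only [h2] at hζ
      rw [← Finset.mul_sum] at hζ
      exact (mul_eq_zero.1 hζ).resolve_left hE0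
    exact (mul_eq_zero.1 (eq_zero_of_ae_sum_pow_eq_zero h1 j₀)).resolve_right
      (pow_ne_zero _ rtpi_ne_zero)
  · intro h σ hσ F hF
    refine Filter.Eventually.of_forall fun ζ => ?_
    rw [hl σ F ζ hσ hF, hr σ F ζ hσ hF]
    simp only [h]

/-! ### Degrees -/

theorem polyDeg_eq_bot {p : ZPoly} : polyDeg p = ⊥ ↔ p = 0 := by
  unfold polyDeg
  split_ifs with h <;> simp [h]

theorem polyDeg_mul (p q : ZPoly) : polyDeg (p * q) = polyDeg p + polyDeg q := by
  by_cases hp : p = 0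
  · simp [polyDeg, hp]
  by_cases hq : q = 0
  · simp [polyDeg, hq]
  rw [polyDeg, polyDeg, polyDeg, if_neg hp, if_neg hq, if_neg (mul_ne_zero hp hq),
    totalDegree_mul_of_isDomain hp hq, Nat.cast_add]

theorem polyDeg_conjPoly (p : ZPoly) : polyDeg (conjPoly p) = polyDeg p := by
  simp only [polyDeg, conjPoly_eq_zero, totalDegree_conjPoly]

theorem polyDeg_heat (p : ZPoly) : polyDeg (heat p) = polyDeg p := by
  simp only [polyDeg, heat_eq_zero, totalDegree_heat]

theorem polyDeg_symbolEquiv (p : ZPoly) : polyDeg (symbolEquiv p) = polyDeg p := by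
  simp only [polyDeg, EmbeddingLike.map_eq_zero_iff, totalDegree_symbolEquiv]

theorem polyDeg_heatProd (j k : ℕ) (Ψ Θ : ZPoly) :
    polyDeg (heatProd j k Ψ Θ) = polyDeg (proj k Ψ) + polyDeg (proj j Θ) := by
  rw [heatProd, polyDeg_heat, polyDeg_mul, polyDeg_conjPoly]

/-- Multiplying the identities for the holomorphic components by the nonzero `windowFactor k j`
expresses them through the projections. -/
theorem localizationIdentity_iff_heatProd {n : ℕ} {Ψ Ψs Θ Θs : ZPoly}
    (hΨ : polyFun Ψ ∈ polyFock n) (hΨs : polyFun Ψs ∈ polyFock n)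
    (hΘ : polyFun Θ ∈ polyFock n) (hΘs : polyFun Θs ∈ polyFock n)
    (D : Fin (n + 1) → Fin (n + 1) → ZPoly) :
    LocalizationIdentity n Ψ Θ Ψs Θs D ↔ ∀ j k : Fin (n + 1),
      heatProd j k Ψ Θ = symbolEquiv (D j k) * heatProd j k Ψs Θs := by
  obtain ⟨φ, hφ, hφp, hφd⟩ := exists_proj_eq_raise hΨ
  obtain ⟨φs, hφs, hφsp, -⟩ := exists_proj_eq_raise hΨs
  obtain ⟨θ, hθ, hθp, hθd⟩ := exists_proj_eq_raise hΘ
  obtain ⟨θs, hθs, hθsp, -⟩ := exists_proj_eq_raise hΘs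
  rw [localizationIdentity_iff hφ hφs hθ hθs hφd hθd hφsp hθsp]
  refine forall_congr' fun j => forall_congr' fun k => ?_
  have hj := Nat.lt_succ_iff.1 j.2
  have hk := Nat.lt_succ_iff.1 k.2
  rw [heatProd, heatProd, hφp k hk, hφsp k hk, hθp j hj, hθsp j hj,
    heat_raise_mul_conj_raise (hφ k) (hθ j), heat_raise_mul_conj_raise (hφs k) (hθs j),
    mul_left_comm]
  exact ⟨fun h => by rw [h], fun h => mul_left_cancel₀ (windowFactor_ne_zero k j) h⟩

end PolyFock

end

/-! ### The equivalences, uniqueness and the degree formula -/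

theorem corollary3p8 (n : ℕ) (Ψ Ψs Θ Θs : PolyFock.ZPoly)
    (hΨ : PolyFock.polyFun Ψ ∈ PolyFock.polyFock n)
    (hΨs : PolyFock.polyFun Ψs ∈ PolyFock.polyFock n)
    (hΘ : PolyFock.polyFun Θ ∈ PolyFock.polyFock n)
    (hΘs : PolyFock.polyFun Θs ∈ PolyFock.polyFock n) :
    -- (a) is equivalent to (b)
    ((∃! D : Fin (n + 1) → Fin (n + 1) → PolyFock.ZPoly,
        PolyFock.LocalizationIdentity n Ψ Θ Ψs Θs D) ↔
      ∀ j k : Fin (n + 1), PolyFock.heatProd j k Ψs Θs ≠ 0 ∧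
        PolyFock.heatProd j k Ψs Θs ∣ PolyFock.heatProd j k Ψ Θ) ∧
    -- the same without uniqueness, where the divisors may be zero
    ((∃ D : Fin (n + 1) → Fin (n + 1) → PolyFock.ZPoly,
        PolyFock.LocalizationIdentity n Ψ Θ Ψs Θs D) ↔
      ∀ j k : Fin (n + 1), PolyFock.heatProd j k Ψs Θs ∣ PolyFock.heatProd j k Ψ Θ) ∧
    -- if (a) or (b) holds: the identity for every symbol in BC^∞, uniqueness, and the degrees
    (((∃! D : Fin (n + 1) → Fin (n + 1) → PolyFock.ZPoly,
        PolyFock.LocalizationIdentity n Ψ Θ Ψs Θs D) ∨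
      (∀ j k : Fin (n + 1), PolyFock.heatProd j k Ψs Θs ≠ 0 ∧
        PolyFock.heatProd j k Ψs Θs ∣ PolyFock.heatProd j k Ψ Θ)) →
      ∃ D : Fin (n + 1) → Fin (n + 1) → PolyFock.ZPoly,
        PolyFock.LocalizationIdentity n Ψ Θ Ψs Θs D ∧
        (∀ D' : Fin (n + 1) → Fin (n + 1) → PolyFock.ZPoly,
          PolyFock.LocalizationIdentity n Ψ Θ Ψs Θs D' → D' = D) ∧
        ∀ j k : Fin (n + 1),
          PolyFock.polyDeg (PolyFock.proj j Θs) ≠ ⊥ ∧ PolyFock.polyDeg (PolyFock.proj k Ψs) ≠ ⊥ ∧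
          PolyFock.polyDeg (D j k) + PolyFock.polyDeg (PolyFock.proj j Θs) +
              PolyFock.polyDeg (PolyFock.proj k Ψs) =
            PolyFock.polyDeg (PolyFock.proj j Θ) + PolyFock.polyDeg (PolyFock.proj k Ψ)) := by
  classical
  have key := PolyFock.localizationIdentity_iff_heatProd hΨ hΨs hΘ hΘs
  have hex : (∃ D : Fin (n + 1) → Fin (n + 1) → PolyFock.ZPoly,
        PolyFock.LocalizationIdentity n Ψ Θ Ψs Θs D) ↔
      ∀ j k : Fin (n + 1), PolyFock.heatProd j k Ψs Θs ∣ PolyFock.heatProd j k Ψ Θ := by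
    constructor
    · rintro ⟨D, hD⟩ j k
      exact Dvd.intro_left _ ((key D).1 hD j k).symm
    · intro h
      choose c hc using h
      refine ⟨fun j k => PolyFock.symbolEquiv.symm (c j k), (key _).2 fun j k => ?_⟩
      rw [RingEquiv.apply_symm_apply, mul_comm]
      exact hc j k
  have huniq : ∀ D D' : Fin (n + 1) → Fin (n + 1) → PolyFock.ZPoly,
      (∀ j k : Fin (n + 1), PolyFock.heatProd j k Ψs Θs ≠ 0) →
      PolyFock.LocalizationIdentity n Ψ Θ Ψs Θs D →
      PolyFock.LocalizationIdentity n Ψ Θ Ψs Θs D' → D' = D := by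
    intro D D' h0 hD hD'
    funext j k
    exact PolyFock.symbolEquiv.injective (mul_right_cancel₀ (h0 j k)
      (((key D').1 hD' j k).symm.trans ((key D).1 hD j k)))
  have hab : (∃! D : Fin (n + 1) → Fin (n + 1) → PolyFock.ZPoly,
        PolyFock.LocalizationIdentity n Ψ Θ Ψs Θs D) ↔
      ∀ j k : Fin (n + 1), PolyFock.heatProd j k Ψs Θs ≠ 0 ∧
        PolyFock.heatProd j k Ψs Θs ∣ PolyFock.heatProd j k Ψ Θ := by
    constructor
    · rintro ⟨D, hD, hu⟩ j k
      refine ⟨fun h0 => ?_, hex.1 ⟨D, hD⟩ j k⟩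
      -- If `Q⋆_{j,k} = 0`, the symbol `D j k` is unconstrained, and adding `1` to it contradicts
      -- uniqueness.
      have h1 : PolyFock.LocalizationIdentity n Ψ Θ Ψs Θs
          (Function.update D j (Function.update (D j) k (D j k + 1))) := by
        refine (key _).2 fun j' k' => ?_
        by_cases hj : j' = j
        · subst hj
          by_cases hk : k' = k
          · subst hk
            rw [(key D).1 hD, h0, mul_zero, mul_zero]
          · rw [Function.update_self, Function.update_of_ne hk]
            exact (key D).1 hD j' k'
        · rw [Function.update_of_ne hj]
          exact (key D).1 hD j' k'
      have h2 := congrFun (congrFun (hu _ h1) j) k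
      rw [Function.update_self, Function.update_self] at h2
      exact one_ne_zero (add_eq_left.1 h2)
    · intro h
      obtain ⟨D, hD⟩ := hex.2 fun j k => (h j k).2
      exact ⟨D, hD, fun D' hD' => huniq D D' (fun j k => (h j k).1) hD hD'⟩
  refine ⟨hab, hex, fun h => ?_⟩
  have hb := h.elim hab.1 id
  obtain ⟨D, hD⟩ := hex.2 fun j k => (hb j k).2
  refine ⟨D, hD, fun D' hD' => huniq D D' (fun j k => (hb j k).1) hD hD', fun j k => ?_⟩
  have h0 := (hb j k).1
  -- A sum in `WithBot ℕ` is `⊥` only if a summand is, so `Q⋆_{j,k} ≠ 0` forces both projections to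
  -- be nonzero.
  rw [Ne, ← PolyFock.polyDeg_eq_bot, PolyFock.polyDeg_heatProd, WithBot.add_eq_bot, not_or] at h0
  refine ⟨h0.2, h0.1, ?_⟩
  have h1 := congrArg PolyFock.polyDeg ((key D).1 hD j k)
  rw [PolyFock.polyDeg_mul, PolyFock.polyDeg_symbolEquiv, PolyFock.polyDeg_heatProd,
    PolyFock.polyDeg_heatProd] at h1
  rw [add_assoc, add_comm (PolyFock.polyDeg (PolyFock.proj j Θs)), ← h1, add_comm]
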